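/- Let $G$ be a finite, nonempty, undirected multigraph without loops (parallel edges are allowed). For distinct vertices $u,v$ let $\mu_G(u,v)$ be the number of edges joining $u$ and $v$, and let $\mu_G(v)=\max\{\mu_G(u,v):u\in V(G)\setminus\{v\}\}$ (with $\mu_G(v)=0$ if $v$ is the only vertex). For $X\subseteq V(G)$ and $v\in V(G)$ let $d_X(v)$ be the number of edges between $v$ and $X\setminus\{v\}$, and let $d_G(v)=d_{V(G)}(v)$. Triangles and quadrilaterals are the cycles of length $3$ and $4$ (not necessarily induced) of the underlying simple graph of $G$; that is, two cycles that differ only in the choice of parallel edges are regarded as the same. Suppose that no quadrilateral of $G$ shares an edge with a triangle or with another quadrilateral, and let $a,b:V(G)\to\mathbb{N}\setminus\{0,1\}$ be two functions. If $$d_G(x)\ge a(x)+b(x)+2\mu_G(x)-3\qquad\text{for every }x\in V(G),$$ then $V(G)$ is the union of two disjoint nonempty sets $X$ and $Y$ such that $d_X(x)\ge a(x)$ for every $x\in X$ and $d_Y(y)\ge b(y)$ for every $y\in Y$. -/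

import Mathlib

/-!
Multigraphs are Mathlib's `Graph α β`, with vertex set `V(G)`, edge set `E(G)`, and `G.IsLink e u v`
for "the edge `e` joins `u` and `v`".
-/

open scoped Graph

namespace Graph

variable {α β : Type*}

/-- `d_X(v)`: the number of edges between `v` and `X \ {v}`. -/
noncomputable def degIn (G : Graph α β) (X : Set α) (v : α) : ℕ :=
  {e | ∃ u ∈ X \ {v}, G.IsLink e v u}.ncard

/-- `μ_G(u, v)`: the number of edges joining `u` and `v`. -/
noncomputable def multiplicity (G : Graph α β) (u v : α) : ℕ :=
  {e | G.IsLink e u v}.ncard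

/-- `μ_G(v)`: the largest multiplicity `μ_G(u, v)` with `u ∈ V(G) \ {v}`
(a maximum over a finite set; `0` if `v` is the only vertex). -/
noncomputable def weight (G : Graph α β) (v : α) : ℕ :=
  sSup ((fun u => G.multiplicity u v) '' (V(G) \ {v}))

/-- `T` is the set of vertex pairs joined along some triangle of `G`. -/
def IsTriangle (G : Graph α β) (T : Set (Sym2 α)) : Prop :=
  ∃ x y z : α, [x, y, z].Nodup ∧ G.Adj x y ∧ G.Adj y z ∧ G.Adj z x ∧
    T = {s(x, y), s(y, z), s(z, x)}

/-- `Q` is the set of vertex pairs joined along some quadrilateral (4-cycle, not necessarily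
induced) of `G`. Replacing an edge by a parallel one does not change the quadrilateral. -/
def IsQuadrilateral (G : Graph α β) (Q : Set (Sym2 α)) : Prop :=
  ∃ w x y z : α, [w, x, y, z].Nodup ∧ G.Adj w x ∧ G.Adj x y ∧ G.Adj y z ∧ G.Adj z w ∧
    Q = {s(w, x), s(x, y), s(y, z), s(z, w)}

/-- No quadrilateral of `G` shares an edge with a triangle or with another quadrilateral. -/
def QuadrilateralsShareNoEdges (G : Graph α β) : Prop :=
  ∀ Q, G.IsQuadrilateral Q →
    (∀ T, G.IsTriangle T → Disjoint Q T) ∧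
    (∀ Q', G.IsQuadrilateral Q' → Q' ≠ Q → Disjoint Q Q')

/-- `(X, Y)` is a partition of `V(G)` into two nonempty sets such that `d_X(x) ≥ a(x)` for
`x ∈ X` and `d_Y(y) ≥ b(y)` for `y ∈ Y`. -/
structure IsFeasiblePartition (G : Graph α β) (a b : α → ℕ) (X Y : Set α) : Prop where
  left_nonempty : X.Nonempty
  right_nonempty : Y.Nonempty
  disjoint : Disjoint X Y
  union_eq : X ∪ Y = V(G)
  left_feasible : ∀ x ∈ X, a x ≤ G.degIn X x
  right_feasible : ∀ y ∈ Y, b y ≤ G.degIn Y y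

end Graph

set_option linter.unusedSectionVars false

/-! It suffices to find disjoint nonempty sets, one feasible for `a` and one for `b`: enlarge the
second as far as possible, and the degree bound makes its complement feasible for `a`. Suppose there
is no such pair. Then every set disjoint from a feasible set is degenerate for the other function
(`Deg`), and a minimal feasible set minus one vertex gives a triple `A`, `x`, `B` with both sides
degenerate.

Take a triple maximizing `psi`, which weighs the edges inside the two sides and penalizes a centre
with few neighbours on a side. A vertex may be transferred across, or exchanged with the centre, as
long as degeneracy survives. No such move raises the potential, and the degree bound leaves so
little slack that admissible moves force equalities and lead to further maximum triples (`Max.fill`,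
`Max.le_left`, `Max.swap`).

The cycle condition then enters. If the centre can be absorbed into one side, every low vertex of
one side is adjacent to every low vertex of the other; two on each side would create two
quadrilaterals sharing an edge (`PairMax.not_low_quad`). This yields stars (`Max.exists_star`). In a
star with the most low vertices the centre lies on a triangle with pendant edges
(`BigStar.exists_corner`). The same analysis at the other two corners gives the symmetric `Config`.
There a low vertex of each remaining side is adjacent to all three pendant vertices, and two
vertices with three common neighbours again give quadrilaterals sharing an edge (`Config.false`). -/

/-- A finite multigraph recorded by its edge multiplicities `μ`, with a bound `M` on the
multiplicities at each vertex, in which no quadrilateral shares an edge with a triangle or with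
another quadrilateral. -/
structure Net (V : Type*) where
  μ : V → V → ℤ
  M : V → ℤ
  nonneg : ∀ u v, 0 ≤ μ u v
  symm : ∀ u v, μ u v = μ v u
  self : ∀ v, μ v v = 0
  le_M : ∀ u v, μ u v ≤ M u
  edge_unique_triangle : ∀ u v w w', 0 < μ u v → 0 < μ u w → 0 < μ v w → 0 < μ u w' →
    0 < μ v w' → w = w'
  quad_no_triangle : ∀ x y z w t, 0 < μ x y → 0 < μ y z → 0 < μ z w → 0 < μ w x → x ≠ z → y ≠ w →
    0 < μ x t → 0 < μ y t → False
  quad_unique : ∀ x y z w z' w', 0 < μ x y → 0 < μ y z → 0 < μ z w → 0 < μ w x → x ≠ z → y ≠ w →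
    0 < μ y z' → 0 < μ z' w' → 0 < μ w' x → x ≠ z' → y ≠ w' → z = z' ∧ w = w'

/-! ### Degrees, degenerate sets and triples. -/

namespace Net

variable {V : Type*} [DecidableEq V] {N : Net V} {a b : V → ℤ}

/-- The quadrilaterals `u p v q` and `u p v r` share the edge `u p`, so they coincide. -/
theorem common_nbr_three {u v p q r : V} (huv : u ≠ v) (hup : 0 < N.μ u p) (hvp : 0 < N.μ v p)
    (huq : 0 < N.μ u q) (hvq : 0 < N.μ v q) (hur : 0 < N.μ u r) (hvr : 0 < N.μ v r)
    (hpq : p ≠ q) (hpr : p ≠ r) : q = r := by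
  rw [N.symm] at hvp huq hur
  rw [N.symm] at hvp
  exact (N.quad_unique u p v q v r hup (by rwa [N.symm]) hvq huq huv hpq (by rwa [N.symm]) hvr hur
    huv hpr).2

theorem not_adj_self (v : V) : ¬ 0 < N.μ v v := by simp [N.self]

theorem ne_of_adj {u v : V} (h : 0 < N.μ u v) : u ≠ v := by
  rintro rfl
  exact not_adj_self _ h

theorem eq_zero_of_not_adj {u v : V} (h : ¬ 0 < N.μ u v) : N.μ u v = 0 :=
  le_antisymm (not_lt.mp h) (N.nonneg _ _)

/-- The number of edges between `v` and `S`. -/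
def d (N : Net V) (S : Finset V) (v : V) : ℤ := ∑ u ∈ S, N.μ v u

theorem d_insert {S : Finset V} {u : V} (h : u ∉ S) (v : V) :
    N.d (insert u S) v = N.d S v + N.μ v u := by
  rw [d, Finset.sum_insert h, add_comm, d]

theorem d_erase {S : Finset V} {u : V} (h : u ∈ S) (v : V) :
    N.d (S.erase u) v = N.d S v - N.μ v u := by
  rw [d, d, ← Finset.sum_erase_add S _ h]
  ring

theorem d_mono {S T : Finset V} (h : S ⊆ T) (v : V) : N.d S v ≤ N.d T v :=
  Finset.sum_le_sum_of_subset_of_nonneg h fun _ _ _ => N.nonneg _ _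

theorem exists_adj_of_d_pos {S : Finset V} {v : V} (h : 0 < N.d S v) : ∃ u ∈ S, 0 < N.μ v u := by
  by_contra! hc
  exact absurd (Finset.sum_nonpos hc) (not_le.mpr h)

/-- If some neighbours of `v` are deleted and the degree drops, then one of them is adjacent. -/
theorem exists_adj_of_d_lt {S T : Finset V} (hTS : T ⊆ S) {v : V} (h : N.d T v < N.d S v) :
    ∃ u ∈ S \ T, 0 < N.μ v u := by
  apply exists_adj_of_d_pos
  have : N.d (S \ T) v + N.d T v = N.d S v := Finset.sum_sdiff hTS
  linarith

/-- Every nonempty subset of `A` has a vertex of degree less than `a` in it. -/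
def Deg (N : Net V) (a : V → ℤ) (A : Finset V) : Prop :=
  ∀ S ⊆ A, S.Nonempty → ∃ v ∈ S, N.d S v < a v

theorem Deg.mono {A A' : Finset V} (h : N.Deg a A) (hs : A' ⊆ A) : N.Deg a A' :=
  fun S hS => h S (hS.trans hs)

theorem Deg.insert {A : Finset V} {u : V} (h : N.Deg a A) (hu : N.d A u < a u) :
    N.Deg a (insert u A) := by
  intro S hS hne
  by_cases hmem : u ∈ S
  · refine ⟨u, hmem, lt_of_le_of_lt ?_ hu⟩
    have h1 : N.d (S.erase u) u ≤ N.d A u := d_mono (by grind) u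
    rw [d_erase hmem, N.self] at h1
    linarith
  · exact h S (by grind) hne

theorem exists_feasible_of_not_deg {A : Finset V} (h : ¬ N.Deg a A) :
    ∃ S ⊆ A, S.Nonempty ∧ ∀ v ∈ S, a v ≤ N.d S v := by
  simpa [Deg] using h

/-- The vertices of `A` of degree less than `a` in `A`. -/
def low (N : Net V) (a : V → ℤ) (A : Finset V) : Finset V := A.filter fun v => N.d A v < a v

theorem mem_low {A : Finset V} {v : V} : v ∈ N.low a A ↔ v ∈ A ∧ N.d A v < a v := by
  simp [low]

theorem Deg.low_nonempty {A : Finset V} (h : N.Deg a A) (hA : A.Nonempty) :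
    ∃ z, z ∈ N.low a A := by
  obtain ⟨v, hv, hlt⟩ := h A subset_rfl hA
  exact ⟨v, mem_low.mpr ⟨hv, hlt⟩⟩

/-- Twice the number of edges inside `S` minus twice the sum of `a` over `S`. -/
def f (N : Net V) (a : V → ℤ) (S : Finset V) : ℤ := ∑ v ∈ S, (N.d S v - 2 * a v)

theorem f_insert {S : Finset V} {u : V} (h : u ∉ S) :
    N.f a (insert u S) = N.f a S + 2 * (N.d S u - a u) := by
  have h1 : N.d S u = ∑ v ∈ S, N.μ v u := Finset.sum_congr rfl fun v _ => N.symm _ _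
  simp only [f]
  rw [Finset.sum_insert h, d_insert h, N.self]
  simp only [d_insert h]
  have : ∑ v ∈ S, (N.d S v + N.μ v u - 2 * a v) = ∑ v ∈ S, (N.d S v - 2 * a v) + N.d S u := by
    rw [h1, ← Finset.sum_add_distrib]
    exact Finset.sum_congr rfl fun v _ => by ring
  rw [this]
  ring

theorem f_erase {S : Finset V} {u : V} (h : u ∈ S) :
    N.f a (S.erase u) = N.f a S - 2 * (N.d S u - a u) := by
  have h1 := f_insert (N := N) (a := a) (Finset.notMem_erase u S)
  rw [Finset.insert_erase h, d_erase h, N.self] at h1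
  linarith

variable [Fintype V]

/-- The degree hypotheses, together with the assumption that there are no disjoint nonempty
feasible sets. -/
structure Hyp (N : Net V) (a b : V → ℤ) : Prop where
  ha : ∀ v, 2 ≤ a v
  hb : ∀ v, 2 ≤ b v
  deg : ∀ v, a v + b v + 2 * N.M v - 3 ≤ N.d Finset.univ v
  nopair : ∀ S T : Finset V, S.Nonempty → T.Nonempty → Disjoint S T →
    (∀ v ∈ S, a v ≤ N.d S v) → (∀ v ∈ T, b v ≤ N.d T v) → False

theorem Hyp.symm (H : Hyp N a b) : Hyp N b a where
  ha := H.hb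
  hb := H.ha
  deg v := by linarith [H.deg v]
  nopair S T hS hT hd h1 h2 := H.nopair T S hT hS hd.symm h2 h1

theorem one_le_M (ha : ∀ v, 2 ≤ a v) (hb : ∀ v, 2 ≤ b v)
    (deg : ∀ v, a v + b v + 2 * N.M v - 3 ≤ N.d Finset.univ v) (v : V) : 1 ≤ N.M v := by
  by_contra! hc
  have h0 : 0 ≤ N.M v := by simpa [N.self] using N.le_M v v
  have h1 : N.d Finset.univ v ≤ 0 :=
    Finset.sum_nonpos fun u _ => by have := N.le_M v u; omega
  linarith [deg v, ha v, hb v]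

theorem Hyp.one_le_M (H : Hyp N a b) (v : V) : 1 ≤ N.M v := Net.one_le_M H.ha H.hb H.deg v

/-- The form in which the absence of a feasible pair is used: it certifies that the new sides are
degenerate when a vertex is moved. -/
theorem Hyp.deg_of_disjoint (H : Hyp N a b) {S T : Finset V} (hS : S.Nonempty)
    (hf : ∀ v ∈ S, a v ≤ N.d S v) (hd : Disjoint S T) : N.Deg b T := by
  intro R hR hne
  by_contra! hc
  exact H.nopair S R hS hne (hd.mono_right hR) hf hc

/-- `A`, `{x}`, `B` partition the vertices, `A` has no `a`-feasible subset and `B` has no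
`b`-feasible subset. -/
structure Triple (N : Net V) (a b : V → ℤ) (A : Finset V) (x : V) (B : Finset V) : Prop where
  xA : x ∉ A
  xB : x ∉ B
  disj : ∀ v ∈ A, v ∉ B
  cover : ∀ v, v = x ∨ v ∈ A ∨ v ∈ B
  degA : N.Deg a A
  degB : N.Deg b B

/-- The potential of a triple. -/
def psi (N : Net V) (a b : V → ℤ) (A : Finset V) (x : V) (B : Finset V) : ℤ :=
  N.f a A + N.f b B - 2 * max 0 (a x - 1 - N.d A x) - 2 * max 0 (b x - 1 - N.d B x)

/-- A triple of maximum potential. -/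
structure Max (N : Net V) (a b : V → ℤ) (A : Finset V) (x : V) (B : Finset V) : Prop extends
    Triple N a b A x B where
  le : ∀ A' x' B', Triple N a b A' x' B' → N.psi a b A' x' B' ≤ N.psi a b A x B

section Triple

variable {A B : Finset V} {x : V}

theorem Triple.symm (h : Triple N a b A x B) : Triple N b a B x A where
  xA := h.xB
  xB := h.xA
  disj v hv hv' := h.disj v hv' hv
  cover v := by have := h.cover v; tauto
  degA := h.degB
  degB := h.degA

theorem psi_symm (A B : Finset V) (x : V) : N.psi b a B x A = N.psi a b A x B := by
  unfold psi; ring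

theorem Max.symm (h : Max N a b A x B) : Max N b a B x A where
  toTriple := h.toTriple.symm
  le A' x' B' h' := by
    rw [psi_symm, psi_symm A]
    exact h.le _ _ _ h'.symm

theorem Max.of_ge (h : Max N a b A x B) {A' B' : Finset V} {x' : V} (h' : Triple N a b A' x' B')
    (hle : N.psi a b A x B ≤ N.psi a b A' x' B') : Max N a b A' x' B' where
  toTriple := h'
  le _ _ _ h'' := (h.le _ _ _ h'').trans hle

theorem Triple.tot (h : Triple N a b A x B) (v : V) :
    N.d A v + N.d B v + N.μ v x = N.d Finset.univ v := by
  have h1 : (Finset.univ : Finset V) = insert x (A ∪ B) := by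
    ext u
    simpa using h.cover u
  have h2 : Disjoint A B := Finset.disjoint_left.mpr h.disj
  have h3 : x ∉ A ∪ B := by simp [h.xA, h.xB]
  rw [h1, d_insert h3]
  unfold d
  rw [Finset.sum_union h2]

theorem Triple.transfer (h : Triple N a b A x B) {y : V} (hy : y ∈ B)
    (hd : N.Deg a (insert y A)) : Triple N a b (insert y A) x (B.erase y) where
  xA := by have := h.xA; have := h.xB; grind
  xB := by have := h.xB; grind
  disj v := by have := h.disj v; grind
  cover v := by have := h.cover v; grind
  degA := hd
  degB := h.degB.mono (Finset.erase_subset _ _)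

theorem Triple.recenter (h : Triple N a b A x B) {y : V} (hy : y ∈ B)
    (hd : N.Deg b (insert x (B.erase y))) : Triple N a b A y (insert x (B.erase y)) where
  xA := by have := h.disj y; grind
  xB := by have := h.xB; grind
  disj v := by have := h.disj v; have := h.xA; grind
  cover v := by have := h.cover v; grind
  degA := h.degA
  degB := hd

theorem Triple.recenter_cross (h : Triple N a b A x B) {y : V} (hy : y ∈ B)
    (hd : N.Deg a (insert x A)) : Triple N a b (insert x A) y (B.erase y) where
  xA := by have := h.disj y; have := h.xB; grind
  xB := by grind
  disj v := by have := h.disj v; have := h.xB; grind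
  cover v := by have := h.cover v; grind
  degA := hd
  degB := h.degB.mono (Finset.erase_subset _ _)

theorem Triple.left_nonempty (H : Hyp N a b) (h : Triple N a b A x B) : A.Nonempty := by
  rw [Finset.nonempty_iff_ne_empty]
  rintro rfl
  have tot := h.tot
  have e : ∀ v, N.d ∅ v = 0 := fun v => by simp [d]
  have hB : B.Nonempty := by
    rw [Finset.nonempty_iff_ne_empty]
    rintro rfl
    have := tot x
    rw [e, N.self] at this
    linarith [H.deg x, H.ha x, H.hb x, H.one_le_M x]
  obtain ⟨y, hy⟩ := h.degB.low_nonempty hB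
  have h1 := (mem_low.mp hy).2
  have h2 := tot y
  rw [e] at h2
  linarith [H.deg y, H.ha y, H.one_le_M y, N.le_M y x]

theorem Triple.right_nonempty (H : Hyp N a b) (h : Triple N a b A x B) : B.Nonempty :=
  h.symm.left_nonempty H.symm

end Triple

end Net

/-! ### Moves on maximum triples and pairs. -/

namespace Net

variable {V : Type*} [DecidableEq V] {N : Net V} {a b : V → ℤ} [Fintype V]
variable {A B : Finset V} {x : V}

/-- If `x` has enough neighbours in `B`, then adding `x` to `B` gives every vertex of `B` degree
at least `b`. -/
theorem Max.fill (H : Hyp N a b) (h : Max N a b A x B) (hx : b x ≤ N.d B x) :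
    ∀ v ∈ B, b v ≤ N.d B v + N.μ v x := by
  obtain ⟨z, hz⟩ := h.degA.low_nonempty (h.left_nonempty H)
  obtain ⟨hzA, hz⟩ := mem_low.mp hz
  have hnd : ¬ N.Deg b (insert x B) := by
    intro hd
    -- Absorbing `x` into `B` costs nothing, and releasing `z` from `A` gains `2 * (a z - d)`, where
    -- `d` is the degree of `z` in `A`. The threshold `a - 1` in the penalty is chosen so that it
    -- takes back all but `2` of this gain.
    have ht := (h.symm.recenter_cross hzA hd).symm
    have h1 := h.le _ _ _ ht
    have tz := h.tot z
    have Hz := H.deg z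
    have Mz := H.one_le_M z
    unfold psi at h1
    rw [f_erase hzA, f_insert h.xB, d_insert h.xB, d_erase hzA, N.self] at h1
    omega
  obtain ⟨S, hS, hne, hf⟩ := exists_feasible_of_not_deg hnd
  have hxS : x ∈ S := by
    by_contra hc
    obtain ⟨v, hv, hlt⟩ := h.degB S (by grind) hne
    exact absurd (hf v hv) (not_le.mpr hlt)
  intro u hu
  by_contra! hc
  have huS : u ∉ S := by
    intro hmem
    have h1 := d_mono (N := N) hS u
    rw [d_insert h.xB] at h1
    linarith [hf u hmem]
  have hdeg : N.Deg a (insert u A) := by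
    refine H.symm.deg_of_disjoint hne hf (Finset.disjoint_left.mpr fun v hv hv' => ?_)
    have := h.disj v
    have := h.xA
    grind
  have ht := h.transfer hu hdeg
  have h1 := h.le _ _ _ ht
  have huA : u ∉ A := fun h' => h.disj u h' hu
  have h2 : b x ≤ N.d (B.erase u) x := by
    have h3 : N.d (S.erase x) x ≤ N.d (B.erase u) x := d_mono (by grind) x
    rw [d_erase hxS, N.self] at h3
    linarith [hf x hxS]
  have tu := h.tot u
  have Hu := H.deg u
  have Mu := H.one_le_M u
  have := N.nonneg x u
  have := N.nonneg u x
  unfold psi at h1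
  rw [f_erase hu, f_insert huA, d_insert huA] at h1
  omega

theorem Max.fill_left (H : Hyp N a b) (h : Max N a b A x B) (hx : a x ≤ N.d A x) :
    ∀ v ∈ A, a v ≤ N.d A v + N.μ v x := h.symm.fill H.symm hx

/-- Otherwise `x` has at least `b x + 2 * N.M x - 1` edges to `B`, and `Max.fill` makes every low
`y` in `B` adjacent to `x`. If `A` with `y` added is degenerate, transferring `y` lowers the penalty
of `x`; if not, it contains a feasible set, so exchanging `x` and `y` is admissible. Either move
raises the potential. Hence the penalties vanish at a maximum triple. -/
theorem Max.le_left (H : Hyp N a b) (h : Max N a b A x B) : a x - 1 ≤ N.d A x := by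
  by_contra! hc
  have tx := h.tot x
  rw [N.self] at tx
  have Hx := H.deg x
  have Mx := H.one_le_M x
  obtain ⟨y, hy⟩ := h.degB.low_nonempty (h.right_nonempty H)
  obtain ⟨hyB, hy⟩ := mem_low.mp hy
  have hfill := h.fill H (by linarith) y hyB
  have hyA : y ∉ A := fun h' => h.disj y h' hyB
  have hxBy : x ∉ B.erase y := by have := h.xB; grind
  have ty := h.tot y
  have Hy := H.deg y
  have My := H.one_le_M y
  have m1 := N.le_M x y
  have m2 := N.le_M y x
  have ms := N.symm x y
  by_cases hd : N.Deg a (insert y A)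
  · have h1 := h.le _ _ _ (h.transfer hyB hd)
    unfold psi at h1
    rw [f_erase hyB, f_insert hyA, d_insert hyA, d_erase hyB] at h1
    omega
  · obtain ⟨S, hS, hne, hf⟩ := exists_feasible_of_not_deg hd
    have hdeg : N.Deg b (insert x (B.erase y)) := by
      refine H.deg_of_disjoint hne hf (Finset.disjoint_left.mpr fun v hv hv' => ?_)
      have := h.disj v
      have := h.xA
      grind
    have h1 := h.le _ _ _ (h.recenter hyB hdeg)
    unfold psi at h1
    rw [f_insert hxBy, f_erase hyB, d_insert hxBy, d_erase hyB, d_erase hyB, N.self] at h1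
    omega

theorem Max.le_right (H : Hyp N a b) (h : Max N a b A x B) : b x - 1 ≤ N.d B x :=
  h.symm.le_left H.symm

theorem Max.psi_eq (H : Hyp N a b) (h : Max N a b A x B) :
    N.psi a b A x B = N.f a A + N.f b B := by
  have := h.le_left H
  have := h.le_right H
  unfold psi
  omega

theorem psi_eq_of_le (h1 : a x - 1 ≤ N.d A x) (h2 : b x - 1 ≤ N.d B x) :
    N.psi a b A x B = N.f a A + N.f b B := by
  unfold psi
  omega

/-- Moving the centre into `A` when it has degree `a - 1` there. -/
theorem Max.recenter_cross (H : Hyp N a b) (h : Max N a b A x B) (hx : N.d A x = a x - 1) {y : V}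
    (hy : y ∈ N.low b B) :
    N.d B y = b y - 1 ∧ Max N a b (insert x A) y (B.erase y) := by
  obtain ⟨hyB, hy⟩ := mem_low.mp hy
  have ht := h.toTriple.recenter_cross hyB (h.degA.insert (by linarith))
  have ty := ht.tot y
  rw [N.self, d_erase hyB, N.self] at ty
  have Hy := H.deg y
  have My := H.one_le_M y
  have hm : Max N a b (insert x A) y (B.erase y) := by
    refine h.of_ge ht ?_
    rw [h.psi_eq H]
    unfold psi
    rw [f_insert h.xA, f_erase hyB, d_erase hyB, N.self]
    omega
  have h1 := hm.le_right H
  rw [d_erase hyB, N.self] at h1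
  exact ⟨by omega, hm⟩

theorem Max.transfer_of_eq (H : Hyp N a b) (h : Max N a b A x B) {y : V} (hyB : y ∈ B)
    (h1 : N.d B y = b y - 1) (h2 : N.d A y = a y - 1) (h3 : b x - 1 ≤ N.d B x - N.μ x y) :
    Max N a b (insert y A) x (B.erase y) := by
  have hyA : y ∉ A := fun h' => h.disj y h' hyB
  refine h.of_ge (h.toTriple.transfer hyB (h.degA.insert (by linarith))) ?_
  have h4 := h.le_left H
  have := N.nonneg x y
  rw [h.psi_eq H, psi_eq_of_le (by rw [d_insert hyA]; linarith) (by rw [d_erase hyB]; linarith),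
    f_insert hyA, f_erase hyB]
  linarith

/-- Either `y` may be transferred to `A`, or `A` with `y` added contains a feasible set and then `x`
and `y` may be exchanged. The degree bound shows that neither move lowers the potential, so
maximality turns every estimate used into an equality and the new triple is again maximum. -/
theorem Max.swap (H : Hyp N a b) (h : Max N a b A x B) {y : V} (hy : y ∈ N.low b B)
    (hx : b x ≤ N.d B x) (hm : b x + N.μ x y - 1 ≤ N.d B x) :
    N.d B y = b y - 1 ∧
      ((N.d B x = b x + N.μ x y - 1 ∧ Max N a b A y (insert x (B.erase y))) ∨
       (N.M y = 1 ∧ N.μ x y = 1 ∧ N.d Finset.univ y = a y + b y - 1 ∧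
          Max N a b (insert y A) x (B.erase y))) := by
  obtain ⟨hyB, hy⟩ := mem_low.mp hy
  have hfill := h.fill H hx y hyB
  have hyA : y ∉ A := fun h' => h.disj y h' hyB
  have hxBy : x ∉ B.erase y := by have := h.xB; grind
  have ty := h.tot y
  have Hy := H.deg y
  have My := H.one_le_M y
  have m1 := N.le_M x y
  have m2 := N.le_M y x
  have ms := N.symm x y
  have hl := h.le_left H
  have hpsi := h.psi_eq H
  by_cases hd : N.Deg a (insert y A)
  · have ht := h.transfer hyB hd
    have hp : N.psi a b (insert y A) x (B.erase y) = _ :=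
      psi_eq_of_le (by rw [d_insert hyA]; linarith) (by rw [d_erase hyB]; linarith)
    rw [f_insert hyA, f_erase hyB] at hp
    have h1 := h.le _ _ _ ht
    exact ⟨by omega, Or.inr ⟨by omega, by omega, by omega, h.of_ge ht (by omega)⟩⟩
  · obtain ⟨S, hS, hne, hf⟩ := exists_feasible_of_not_deg hd
    have hdeg : N.Deg b (insert x (B.erase y)) := by
      refine H.deg_of_disjoint hne hf (Finset.disjoint_left.mpr fun v hv hv' => ?_)
      have := h.disj v
      have := h.xA
      grind
    have ht := h.toTriple.recenter hyB hdeg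
    have hp : N.psi a b A y (insert x (B.erase y)) = _ :=
      psi_eq_of_le (by linarith) (by rw [d_insert hxBy, d_erase hyB, N.self]; linarith)
    rw [f_insert hxBy, f_erase hyB, d_erase hyB] at hp
    have h1 := h.le _ _ _ ht
    exact ⟨by omega, Or.inl ⟨by omega, h.of_ge ht (by omega)⟩⟩

/-- `A` and `B` partition the vertices, and taking out a vertex of degree `a - 1` in `A` gives a
maximum triple. -/
def PairMax (N : Net V) (a b : V → ℤ) (A B : Finset V) : Prop :=
  ∃ x ∈ A, N.d A x = a x - 1 ∧ Max N a b (A.erase x) x B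

theorem Max.pairMax (h : Max N a b A x B) (hx : N.d A x = a x - 1) :
    PairMax N a b (insert x A) B :=
  ⟨x, Finset.mem_insert_self _ _, by rw [d_insert h.xA, N.self, hx, add_zero],
    by rwa [Finset.erase_insert h.xA]⟩

theorem PairMax.right (H : Hyp N a b) (h : PairMax N a b A B) {y : V} (hy : y ∈ N.low b B) :
    N.d B y = b y - 1 ∧ Max N a b A y (B.erase y) := by
  obtain ⟨x, hxA, hx, hm⟩ := h
  have h1 := hm.recenter_cross H (by rw [d_erase hxA, N.self, hx, sub_zero]) hy
  rwa [Finset.insert_erase hxA] at h1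

theorem PairMax.symm (H : Hyp N a b) (h : PairMax N a b A B) : PairMax N b a B A := by
  obtain ⟨x, hxA, hx, hm⟩ := id h
  obtain ⟨y, hy⟩ := hm.degB.low_nonempty (hm.right_nonempty H)
  obtain ⟨h1, h2⟩ := h.right H hy
  exact ⟨y, (mem_low.mp hy).1, h1, h2.symm⟩

theorem PairMax.left (H : Hyp N a b) (h : PairMax N a b A B) {x : V} (hx : x ∈ N.low a A) :
    N.d A x = a x - 1 ∧ Max N a b (A.erase x) x B := by
  obtain ⟨h1, h2⟩ := (h.symm H).right H.symm hx
  exact ⟨h1, h2.symm⟩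

/-- The same pair, read off from a triple whose centre has degree `b - 1` in `B`. -/
theorem Max.pairMax_right (H : Hyp N a b) (h : Max N a b A x B) (hx : N.d B x = b x - 1) :
    PairMax N a b A (insert x B) :=
  (h.symm.pairMax hx).symm H.symm

/-- With `x` taken out as centre, its degree `a x - 1` in `A` leaves at least `b x` edges to `B`, so
`Max.fill` applies and the low `y` needs `x`. -/
theorem PairMax.adj (H : Hyp N a b) (h : PairMax N a b A B) {x y : V} (hx : x ∈ N.low a A)
    (hy : y ∈ N.low b B) : 0 < N.μ x y := by
  obtain ⟨h1, h2⟩ := h.left H hx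
  obtain ⟨hyB, hy⟩ := mem_low.mp hy
  have hxA := (mem_low.mp hx).1
  have tx := h2.tot x
  rw [d_erase hxA, N.self] at tx
  have := h2.fill H (by linarith [H.deg x, H.one_le_M x]) y hyB
  rw [N.symm]
  linarith

theorem PairMax.disj (h : PairMax N a b A B) {v : V} (hv : v ∈ A) : v ∉ B := by
  obtain ⟨x, hxA, -, hm⟩ := h
  have := hm.disj v
  have := hm.xB
  grind

theorem PairMax.degA (h : PairMax N a b A B) : N.Deg a A := by
  obtain ⟨x, hxA, hx, hm⟩ := h
  have := hm.degA.insert (u := x) (by rw [d_erase hxA, N.self]; linarith)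
  rwa [Finset.insert_erase hxA] at this

/-- By `PairMax.adj`, `x y x' y'` is a quadrilateral. Exchanging `x` and `y` gives another maximum
pair, in which `u` and `v` are low and hence adjacent. Then `x y v u` is a second quadrilateral on
the edge `x y`. -/
theorem PairMax.not_low_quad_aux (H : Hyp N a b) (h : PairMax N a b A B) {x x' y y' u v : V}
    (hx : x ∈ N.low a A) (hx' : x' ∈ N.low a A) (hxx' : x ≠ x')
    (hy : y ∈ N.low b B) (hy' : y' ∈ N.low b B) (hyy' : y ≠ y')
    (hu : u ∈ A) (hux : u ≠ x) (huadj : 0 < N.μ u x) (hud : N.d (A.erase x) u < a u)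
    (hv : v ∈ B) (hvy : v ≠ y) (hvadj : 0 < N.μ v y) (hvd : N.d (B.erase y) v < b v) : False := by
  have e1 := h.adj H hx hy
  have e2 := h.adj H hx' hy
  have e3 := h.adj H hx' hy'
  have e4 := h.adj H hx hy'
  have huy : ¬ 0 < N.μ u y := fun h' => N.quad_no_triangle x y x' y' u e1 (by rwa [N.symm]) e3
    (by rwa [N.symm]) hxx' hyy' (by rwa [N.symm]) (by rwa [N.symm])
  have hvx : ¬ 0 < N.μ v x := fun h' => N.quad_no_triangle x y x' y' v e1 (by rwa [N.symm]) e3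
    (by rwa [N.symm]) hxx' hyy' (by rwa [N.symm]) (by rwa [N.symm])
  have huy0 := eq_zero_of_not_adj huy
  have hvx0 := eq_zero_of_not_adj hvx
  obtain ⟨hx1, hmax⟩ := h.left H hx
  have hxA := (mem_low.mp hx).1
  have hyB := (mem_low.mp hy).1
  have hxB := h.disj hxA
  have hyA : y ∉ A := fun h' => h.disj h' hyB
  have hyAx : y ∉ A.erase x := by grind
  have hxBy : x ∉ B.erase y := by grind
  have tx := hmax.tot x
  rw [d_erase hxA, N.self] at tx
  have Hx := H.deg x
  have Mx := H.one_le_M x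
  have m1 := N.le_M x y
  have huA' : u ∈ A.erase x := by grind
  have hvB' : v ∈ B.erase y := by grind
  -- Both outcomes lead to the same pair: a low vertex not adjacent to the centre (`u` in the first
  -- case, `v` in the second) fixes the degree of the centre on its side, so the centre can be
  -- absorbed.
  obtain ⟨-, hsw⟩ := hmax.swap H hy (by linarith) (by linarith)
  have hp : PairMax N a b (insert y (A.erase x)) (insert x (B.erase y)) := by
    rcases hsw with ⟨-, hm⟩ | ⟨-, -, -, hm⟩
    · have hl := hm.le_left H
      refine hm.pairMax (le_antisymm ?_ hl)
      by_contra! hc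
      have := hm.fill_left H (by linarith) u huA'
      linarith
    · have hl := hm.le_right H
      refine hm.pairMax_right H (le_antisymm ?_ hl)
      by_contra! hc
      have := hm.fill H (by linarith) v hvB'
      linarith
  have e5 : 0 < N.μ u v := by
    refine hp.adj H (mem_low.mpr ⟨by grind, ?_⟩) (mem_low.mpr ⟨by grind, ?_⟩)
    · rw [d_insert hyAx]; linarith
    · rw [d_insert hxBy]; linarith
  have hx'v := (N.quad_unique x y x' y' v u e1 (by rwa [N.symm]) e3 (by rwa [N.symm]) hxx' hyy'
    (by rwa [N.symm]) (by rwa [N.symm]) huadj (by grind) (by grind)).1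
  exact h.disj (mem_low.mp hx').1 (hx'v ▸ hv)

/-- Delete `x` and `x'` from `A` and take a vertex `u` of small degree in the rest. It is not low in
`A`, or `y` and `y'` would have three common neighbours; it is not adjacent to both `x` and `x'`, or
these would. So deleting just one of them already makes it low. -/
theorem PairMax.exists_next (H : Hyp N a b) (h : PairMax N a b A B) {x x' y y' : V}
    (hx : x ∈ N.low a A) (hx' : x' ∈ N.low a A) (hxx' : x ≠ x')
    (hy : y ∈ N.low b B) (hy' : y' ∈ N.low b B) (hyy' : y ≠ y') :
    ∃ u ∈ A, (u ≠ x ∧ 0 < N.μ u x ∧ N.d (A.erase x) u < a u) ∨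
      (u ≠ x' ∧ 0 < N.μ u x' ∧ N.d (A.erase x') u < a u) := by
  have e1 := h.adj H hx hy
  have e2 := h.adj H hx' hy
  have e3 := h.adj H hx' hy'
  have e4 := h.adj H hx hy'
  have hxA := (mem_low.mp hx).1
  have hxA' := (mem_low.mp hx').1
  have hnadj : ¬ 0 < N.μ x x' := fun h' =>
    hyy' (N.edge_unique_triangle x x' y y' h' e1 e2 e4 e3)
  have hne : ((A.erase x).erase x').Nonempty := by
    obtain ⟨u, hu, huadj⟩ := exists_adj_of_d_pos (N := N) (S := A) (v := x)
      (by rw [(h.left H hx).1]; linarith [H.ha x])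
    refine ⟨u, ?_⟩
    have := ne_of_adj huadj
    grind
  have hxx'' : x' ∈ A.erase x := by grind
  obtain ⟨u, hu, hud⟩ := h.degA.mono (A' := (A.erase x).erase x') (by grind) _ subset_rfl hne
  have huA : u ∈ A := by grind
  have hux : u ≠ x := by grind
  have hux' : u ≠ x' := by grind
  refine ⟨u, huA, ?_⟩
  have hul : u ∉ N.low a A := fun hl =>
    hux'.symm (common_nbr_three hyy' (by rw [N.symm]; exact e1) (by rw [N.symm]; exact e4)
      (by rw [N.symm]; exact e2) (by rw [N.symm]; exact e3)
      (by rw [N.symm]; exact h.adj H hl hy) (by rw [N.symm]; exact h.adj H hl hy') hxx' hux.symm)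
  have hud2 : a u ≤ N.d A u := by
    by_contra! hc
    exact hul (mem_low.mpr ⟨huA, hc⟩)
  rw [d_erase hxx'', d_erase hxA] at hud
  have hboth : ¬ (0 < N.μ u x ∧ 0 < N.μ u x') := fun ⟨h1, h2⟩ =>
    hyy' (common_nbr_three hxx' (by rw [N.symm]; exact h1) (by rw [N.symm]; exact h2) e1 e2 e4 e3
      (by rintro rfl; exact h.disj huA (mem_low.mp hy).1)
      (by rintro rfl; exact h.disj huA (mem_low.mp hy').1))
  have n1 := N.nonneg u x
  have n2 := N.nonneg u x'
  rw [d_erase hxA, d_erase hxA']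
  by_cases h1 : 0 < N.μ u x
  · exact Or.inl ⟨hux, h1, by grind⟩
  · exact Or.inr ⟨hux', by grind, by grind⟩

/-- In a maximum pair one of the two sets of low vertices is a singleton. -/
theorem PairMax.not_low_quad (H : Hyp N a b) (h : PairMax N a b A B) {x x' y y' : V}
    (hx : x ∈ N.low a A) (hx' : x' ∈ N.low a A) (hxx' : x ≠ x')
    (hy : y ∈ N.low b B) (hy' : y' ∈ N.low b B) (hyy' : y ≠ y') : False := by
  obtain ⟨u, hu, hu'⟩ := h.exists_next H hx hx' hxx' hy hy' hyy'
  obtain ⟨v, hv, hv'⟩ := (h.symm H).exists_next H.symm hy hy' hyy' hx hx' hxx'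
  rcases hu' with ⟨u1, u2, u3⟩ | ⟨u1, u2, u3⟩ <;> rcases hv' with ⟨v1, v2, v3⟩ | ⟨v1, v2, v3⟩
  · exact h.not_low_quad_aux H hx hx' hxx' hy hy' hyy' hu u1 u2 u3 hv v1 v2 v3
  · exact h.not_low_quad_aux H hx hx' hxx' hy' hy hyy'.symm hu u1 u2 u3 hv v1 v2 v3
  · exact h.not_low_quad_aux H hx' hx hxx'.symm hy hy' hyy' hu u1 u2 u3 hv v1 v2 v3
  · exact h.not_low_quad_aux H hx' hx hxx'.symm hy' hy hyy'.symm hu u1 u2 u3 hv v1 v2 v3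

theorem Max.eq_of_low_not_adj (H : Hyp N a b) (h : Max N a b A x B) {z : V}
    (hz : z ∈ N.low a A) (hn : ¬ 0 < N.μ x z) : N.d A x = a x - 1 := by
  refine le_antisymm ?_ (h.le_left H)
  by_contra! hc
  obtain ⟨hzA, hz⟩ := mem_low.mp hz
  have := h.fill_left H (by linarith) z hzA
  rw [N.symm, eq_zero_of_not_adj hn] at this
  linarith

theorem Max.low_insert_of_not_adj (h : Max N a b A x B) {z : V} (hz : z ∈ N.low a A)
    (hn : ¬ 0 < N.μ x z) : z ∈ N.low a (insert x A) := by
  obtain ⟨hzA, hz⟩ := mem_low.mp hz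
  refine mem_low.mpr ⟨by grind, ?_⟩
  rw [d_insert h.xA, N.symm, eq_zero_of_not_adj hn]
  linarith

theorem Max.center_low_insert (h : Max N a b A x B) (hx : N.d A x = a x - 1) :
    x ∈ N.low a (insert x A) := by
  refine mem_low.mpr ⟨by grind, ?_⟩
  rw [d_insert h.xA, N.self]
  linarith

/-- If `x` missed `z`, it could be absorbed into `A`, where `x` and `z` would both be low, against
two low vertices in `B`. -/
theorem Max.adj_of_two_low (H : Hyp N a b) (h : Max N a b A x B) {z y y' : V}
    (hz : z ∈ N.low a A) (hy : y ∈ N.low b B) (hy' : y' ∈ N.low b B) (hyy' : y ≠ y') :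
    0 < N.μ x z := by
  by_contra hn
  have hx := h.eq_of_low_not_adj H hz hn
  exact (h.pairMax hx).not_low_quad H (h.center_low_insert hx) (h.low_insert_of_not_adj hz hn)
    (by rintro rfl; exact h.xA (mem_low.mp hz).1) hy hy' hyy'

theorem Max.adj_of_two_low_left (H : Hyp N a b) (h : Max N a b A x B) {y z z' : V}
    (hy : y ∈ N.low b B) (hz : z ∈ N.low a A) (hz' : z' ∈ N.low a A) (hzz' : z ≠ z') :
    0 < N.μ x y := h.symm.adj_of_two_low H.symm hy hz hz' hzz'

/-- A low vertex of `B` that misses some low vertex of `A` lies on no multiple edge, has degree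
exactly `a + b - 1`, and may be transferred. -/
theorem Max.leaf (H : Hyp N a b) (h : Max N a b A x B) {y z : V} (hy : y ∈ N.low b B)
    (hz : z ∈ N.low a A) (hn : ¬ 0 < N.μ y z)
    (hx : b x ≤ N.d B x) (hm : b x + N.μ x y - 1 ≤ N.d B x) :
    N.M y = 1 ∧ N.μ x y = 1 ∧ N.d B y = b y - 1 ∧ N.d A y = a y - 1 ∧
      Max N a b (insert y A) x (B.erase y) := by
  obtain ⟨h1, h2⟩ := h.swap H hy hx hm
  have hyB := (mem_low.mp hy).1
  have ty := h.tot y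
  have Hy := H.deg y
  have My := H.one_le_M y
  have m2 := N.le_M y x
  have ms := N.symm x y
  rcases h2 with ⟨h3, h4⟩ | ⟨h3, h4, h5, h6⟩
  · have h5 := h4.eq_of_low_not_adj H hz hn
    have h6 : N.μ x y = 1 := by omega
    exact ⟨by omega, h6, h1, h5, h.transfer_of_eq H hyB h1 h5 (by omega)⟩
  · exact ⟨h3, h4, h1, by omega, h6⟩

end Net

/-! ### Stars: existence and independence of low vertices. -/

namespace Net

variable {V : Type*} [DecidableEq V] {N : Net V} {a b : V → ℤ} [Fintype V]
variable {A B : Finset V} {x : V}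

/-- A maximum triple whose centre is adjacent to all low vertices, of which there are at least
three. -/
structure Star (N : Net V) (a b : V → ℤ) (A : Finset V) (x : V) (B : Finset V) : Prop extends
    Max N a b A x B where
  adjA : ∀ z ∈ N.low a A, 0 < N.μ x z
  adjB : ∀ y ∈ N.low b B, 0 < N.μ x y
  three_le : 3 ≤ (N.low a A).card + (N.low b B).card

theorem Star.symm (h : Star N a b A x B) : Star N b a B x A where
  toMax := h.toMax.symm
  adjA := h.adjB
  adjB := h.adjA
  three_le := by have := h.three_le; omega

theorem Max.low_left (H : Hyp N a b) (h : Max N a b A x B) : ∃ z, z ∈ N.low a A :=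
  h.degA.low_nonempty (h.left_nonempty H)

theorem Max.low_right (H : Hyp N a b) (h : Max N a b A x B) : ∃ y, y ∈ N.low b B :=
  h.degB.low_nonempty (h.right_nonempty H)

theorem Max.star_of_two_low_left (H : Hyp N a b) (h : Max N a b A x B)
    (hA : ∀ z ∈ N.low a A, 0 < N.μ x z) {z z' : V} (hz : z ∈ N.low a A) (hz' : z' ∈ N.low a A)
    (hzz' : z ≠ z') : Star N a b A x B where
  toMax := h
  adjA := hA
  adjB y hy := h.adj_of_two_low_left H hy hz hz' hzz'
  three_le := by
    have h1 : 1 < (N.low a A).card := Finset.one_lt_card.mpr ⟨z, hz, z', hz', hzz'⟩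
    have h2 : 0 < (N.low b B).card := Finset.card_pos.mpr (h.low_right H)
    omega

theorem Max.star_of_two_low_right (H : Hyp N a b) (h : Max N a b A x B)
    (hB : ∀ y ∈ N.low b B, 0 < N.μ x y) {y y' : V} (hy : y ∈ N.low b B) (hy' : y' ∈ N.low b B)
    (hyy' : y ≠ y') : Star N a b A x B :=
  (h.symm.star_of_two_low_left H.symm hB hy hy' hyy').symm

theorem Max.low_adj_right (H : Hyp N a b) (h : Max N a b A x B) (hx : b x ≤ N.d B x) :
    ∀ y ∈ N.low b B, 0 < N.μ x y := by
  intro y hy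
  obtain ⟨hyB, hy⟩ := mem_low.mp hy
  rw [N.symm]
  linarith [h.fill H hx y hyB]

theorem Max.low_adj_left (H : Hyp N a b) (h : Max N a b A x B) (hx : a x ≤ N.d A x) :
    ∀ z ∈ N.low a A, 0 < N.μ x z := h.symm.low_adj_right H.symm hx

/-- Absorb `x` into `A` and recentre at a low vertex of `B`: the new centre is adjacent to all low
vertices of the enlarged side, among them `x` and `z`. -/
theorem Max.exists_star_of_not_adj (H : Hyp N a b) (h : Max N a b A x B) {z : V}
    (hz : z ∈ N.low a A) (hn : ¬ 0 < N.μ x z) : ∃ A' x' B', Star N a b A' x' B' := by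
  have hx := h.eq_of_low_not_adj H hz hn
  have hp := h.pairMax hx
  obtain ⟨y, hy⟩ := h.low_right H
  obtain ⟨-, hm⟩ := h.recenter_cross H hx hy
  refine ⟨_, _, _, hm.star_of_two_low_left H (fun u hu => ?_) (h.center_low_insert hx)
    (h.low_insert_of_not_adj hz hn) (by rintro rfl; exact h.xA (mem_low.mp hz).1)⟩
  rw [N.symm]
  exact hp.adj H hu hy

theorem Max.exists_star_of_not_adj_right (H : Hyp N a b) (h : Max N a b A x B) {y : V}
    (hy : y ∈ N.low b B) (hn : ¬ 0 < N.μ x y) : ∃ A' x' B', Star N a b A' x' B' := by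
  obtain ⟨A', x', B', hs⟩ := h.symm.exists_star_of_not_adj H.symm hy hn
  exact ⟨B', x', A', hs.symm⟩

/-- The centre has many neighbours on one of the two sides. -/
theorem Triple.rich (H : Hyp N a b) (h : Triple N a b A x B) :
    b x + N.M x - 1 ≤ N.d B x ∨ a x + N.M x - 1 ≤ N.d A x := by
  have tx := h.tot x
  rw [N.self] at tx
  have := H.deg x
  omega

/-- The remaining case has a single low vertex on each side, `z` and `y`. Removing `y` from `B`
makes a neighbour `v` of `y` low. Exchanging `x` and `y` then produces the low vertices `x` and `v`,
while transferring `y` produces `y` and `z`, unless a centre misses a low vertex, which already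
gives a star. The triangles `x y z` and `x y v` cannot both exist. -/
theorem Max.exists_star_of_rich (H : Hyp N a b) (h : Max N a b A x B)
    (hr : b x + N.M x - 1 ≤ N.d B x) : ∃ A' x' B', Star N a b A' x' B' := by
  have Mx := H.one_le_M x
  by_cases hA : ∀ z ∈ N.low a A, 0 < N.μ x z
  swap
  · push Not at hA
    obtain ⟨z, hz, hn⟩ := hA
    exact h.exists_star_of_not_adj H hz (not_lt.mpr hn)
  obtain ⟨z, hz⟩ := h.low_left H
  obtain ⟨y, hy⟩ := h.low_right H
  have hB := h.low_adj_right H (by linarith)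
  by_cases hcard : 3 ≤ (N.low a A).card + (N.low b B).card
  · exact ⟨A, x, B, h, hA, hB, hcard⟩
  have hYs : ∀ u ∈ N.low b B, u = y := by
    have h2 : 0 < (N.low a A).card := Finset.card_pos.mpr ⟨z, hz⟩
    have h3 : (N.low b B).card ≤ 1 := by omega
    intro u hu
    exact Finset.card_le_one.mp h3 u hu y hy
  obtain ⟨hy1, hsw⟩ := h.swap H hy (by linarith) (by linarith [N.le_M x y])
  have hyB := (mem_low.mp hy).1
  have hxy := hB y hy
  have hxz := hA z hz
  have hzA := (mem_low.mp hz).1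
  have hyA : y ∉ A := fun h' => h.disj y h' hyB
  -- a vertex that becomes low once `y` is removed
  obtain ⟨v, hv⟩ : ∃ v, v ∈ N.low b (B.erase y) := by
    refine (h.degB.mono (Finset.erase_subset _ _)).low_nonempty ?_
    obtain ⟨u, hu, hadj⟩ := exists_adj_of_d_pos (N := N) (S := B) (v := y)
      (by linarith [H.hb y])
    exact ⟨u, by have := ne_of_adj hadj; grind⟩
  obtain ⟨hvB, hvd⟩ := mem_low.mp hv
  rw [d_erase hyB] at hvd
  have hvy : v ≠ y := by grind
  have hvB' : v ∈ B := by grind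
  have hvx : v ≠ x := by rintro rfl; exact h.xB hvB'
  have hvadj : 0 < N.μ v y := by
    by_contra hc
    rw [eq_zero_of_not_adj hc] at hvd
    exact hvy (hYs v (mem_low.mpr ⟨hvB', by linarith⟩))
  have hvz : v ≠ z := by rintro rfl; exact h.disj v hzA hvB'
  have htri : 0 < N.μ z y → ¬ 0 < N.μ x v := fun h1 h2 =>
    hvz (N.edge_unique_triangle x y v z hxy h2 (by rwa [N.symm]) hxz (by rwa [N.symm]))
  have hxBy : x ∉ B.erase y := by have := h.xB; grind
  rcases hsw with ⟨h3, h4⟩ | ⟨h3, h4, h5, h6⟩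
  · by_cases hzy : 0 < N.μ y z
    swap
    · exact h4.exists_star_of_not_adj H hz hzy
    have hxv := eq_zero_of_not_adj (htri (by rwa [N.symm]))
    have hfy : b y ≤ N.d (insert x (B.erase y)) y := by
      rw [d_insert hxBy, d_erase hyB, N.self, N.symm y x]
      linarith
    refine ⟨_, _, _, h4.star_of_two_low_right H (h4.low_adj_right H hfy) (y := x) (y' := v) ?_ ?_
      hvx.symm⟩
    · refine mem_low.mpr ⟨by grind, ?_⟩
      rw [d_insert hxBy, d_erase hyB, N.self]
      linarith
    · refine mem_low.mpr ⟨by grind, ?_⟩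
      rw [d_insert hxBy, d_erase hyB, N.symm v x]
      linarith
  · by_cases hzy : 0 < N.μ z y
    · exact h6.exists_star_of_not_adj_right H hv (htri hzy)
    have hfx : a x ≤ N.d (insert y A) x := by
      rw [d_insert hyA]
      linarith [h.le_left H]
    have ty := h.tot y
    have ms := N.symm x y
    refine ⟨_, _, _, h6.star_of_two_low_left H (h6.low_adj_left H hfx) (z := y) (z' := z) ?_ ?_
      (by rintro rfl; exact hyA hzA)⟩
    · refine mem_low.mpr ⟨by grind, ?_⟩
      rw [d_insert hyA, N.self]
      linarith
    · refine mem_low.mpr ⟨by grind, ?_⟩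
      rw [d_insert hyA, eq_zero_of_not_adj hzy]
      linarith [(mem_low.mp hz).2]

theorem Max.exists_star (H : Hyp N a b) (h : Max N a b A x B) :
    ∃ A' x' B', Star N a b A' x' B' := by
  rcases h.toTriple.rich H with hr | hr
  · exact h.exists_star_of_rich H hr
  · obtain ⟨A', x', B', hs⟩ := h.symm.exists_star_of_rich H.symm hr
    exact ⟨B', x', A', hs.symm⟩

/-- A star with the largest number of low vertices. -/
structure BigStar (N : Net V) (a b : V → ℤ) (A : Finset V) (x : V) (B : Finset V) : Prop extends
    Star N a b A x B where
  card_le : ∀ A' x' B', Star N a b A' x' B' →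
    (N.low a A').card + (N.low b B').card ≤ (N.low a A).card + (N.low b B).card

theorem BigStar.symm (h : BigStar N a b A x B) : BigStar N b a B x A where
  toStar := h.toStar.symm
  card_le A' x' B' h' := by
    have := h.card_le _ _ _ h'.symm
    omega

theorem Star.leaf (H : Hyp N a b) (hr : b x + N.M x - 1 ≤ N.d B x)
    (h : Star N a b A x B) {y z : V} (hy : y ∈ N.low b B)
    (hz : z ∈ N.low a A) (hn : ¬ 0 < N.μ y z) :
    N.M y = 1 ∧ N.μ x y = 1 ∧ N.d B y = b y - 1 ∧ N.d A y = a y - 1 ∧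
      Max N a b (insert y A) x (B.erase y) :=
  h.toMax.leaf H hy hz hn (by linarith [H.one_le_M x]) (by linarith [N.le_M x y])

/-- If `y` and `y'` were adjacent, the triangle `x y y'` would keep both from a low `z` in `A`, so
`Max.leaf` applies to each. After transferring `y`, the degree of `y'` is too small even with `x`
added to its side: this contradicts `Max.fill`, or makes `y'` and `z` adjacent by `PairMax.adj`. -/
theorem Star.low_indep (H : Hyp N a b) (hr : b x + N.M x - 1 ≤ N.d B x)
    (h : Star N a b A x B) {y y' : V} (hy : y ∈ N.low b B)
    (hy' : y' ∈ N.low b B) : ¬ 0 < N.μ y y' := by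
  intro hadj
  obtain ⟨z, hz⟩ := h.low_left H
  have hzA := (mem_low.mp hz).1
  have hyB := (mem_low.mp hy).1
  have hyB' := (mem_low.mp hy').1
  have hxz := h.adjA z hz
  have hxy := h.adjB y hy
  have hxy' := h.adjB y' hy'
  have hyA : y ∉ A := fun h' => h.disj y h' hyB
  have hzy : z ≠ y := by rintro rfl; exact hyA hzA
  have hzy' : z ≠ y' := by rintro rfl; exact h.disj _ hzA hyB'
  have hyy' := ne_of_adj hadj
  have n1 : ¬ 0 < N.μ y z := fun h1 =>
    hzy' (N.edge_unique_triangle x y z y' hxy hxz h1 hxy' hadj)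
  have n2 : ¬ 0 < N.μ y' z := fun h1 =>
    hzy (N.edge_unique_triangle x y' z y hxy' hxz h1 hxy (by rwa [N.symm]))
  obtain ⟨-, l1, l2, l3, l4⟩ := h.leaf H hr hy hz n1
  obtain ⟨-, l1', l2', l3', -⟩ := h.leaf H hr hy' hz n2
  have ms := N.symm x y'
  have ms' := N.symm y y'
  have hxBy : x ∉ B.erase y := by have := h.xB; grind
  have hl := l4.le_right H
  by_cases hc : b x ≤ N.d (B.erase y) x
  · have := l4.fill H hc y' (by grind)
    rw [d_erase hyB] at this
    linarith
  · refine n2 ?_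
    rw [N.symm]
    refine (l4.pairMax_right H (by omega)).adj H (mem_low.mpr ⟨by grind, ?_⟩)
      (mem_low.mpr ⟨by grind, ?_⟩)
    · rw [d_insert hyA, N.symm, eq_zero_of_not_adj n1]
      linarith [(mem_low.mp hz).2]
    · rw [d_insert hxBy, d_erase hyB]
      linarith

end Net

/-! ### Largest stars. -/

namespace Net

variable {V : Type*} [DecidableEq V] {N : Net V} {a b : V → ℤ} [Fintype V]
variable {A B : Finset V} {x : V}

theorem low_erase {y y' : V} (hy' : y' ∈ N.low b B) (hne : y' ≠ y) : y' ∈ N.low b (B.erase y) := by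
  obtain ⟨h1, h2⟩ := mem_low.mp hy'
  exact mem_low.mpr ⟨by grind, lt_of_le_of_lt (d_mono (Finset.erase_subset _ _) _) h2⟩

theorem low_insert {y z : V} (hz : z ∈ N.low a A) (hy : y ∉ A) (hn : ¬ 0 < N.μ y z) :
    z ∈ N.low a (insert y A) := by
  obtain ⟨h1, h2⟩ := mem_low.mp hz
  refine mem_low.mpr ⟨by grind, ?_⟩
  rw [d_insert hy, N.symm, eq_zero_of_not_adj hn]
  linarith

theorem low_insert_self {y : V} (hy : y ∉ A) (hd : N.d A y = a y - 1) :
    y ∈ N.low a (insert y A) := by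
  refine mem_low.mpr ⟨by grind, ?_⟩
  rw [d_insert hy, N.self]
  linarith

theorem le_d_of_not_low {v : V} (hv : v ∈ B) (hn : v ∉ N.low b B) : b v ≤ N.d B v := by
  by_contra! hc
  exact hn (mem_low.mpr ⟨hv, hc⟩)

/-- Otherwise two low vertices on one side and one on the other would span two triangles through a
common edge at `x`. -/
theorem Star.exists_not_adj (H : Hyp N a b) (h : Star N a b A x B) :
    ∃ y ∈ N.low b B, ∃ z ∈ N.low a A, ¬ 0 < N.μ y z := by
  by_contra! hc
  obtain ⟨z, hz⟩ := h.low_left H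
  obtain ⟨y, hy⟩ := h.low_right H
  have h3 := h.three_le
  rcases Nat.lt_or_ge 1 (N.low a A).card with h1 | h1
  · obtain ⟨p, hp, q, hq, hpq⟩ := Finset.one_lt_card.mp h1
    exact hpq (N.edge_unique_triangle x y p q (h.adjB y hy) (h.adjA p hp) (hc y hy p hp)
      (h.adjA q hq) (hc y hy q hq))
  · have h2 : 1 < (N.low b B).card := by omega
    obtain ⟨p, hp, q, hq, hpq⟩ := Finset.one_lt_card.mp h2
    exact hpq (N.edge_unique_triangle x z p q (h.adjA z hz) (h.adjB p hp)
      (by rw [N.symm]; exact hc p hp z hz) (h.adjB q hq) (by rw [N.symm]; exact hc q hq z hz))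

/-- A vertex that turns low once a leaf is transferred is adjacent to the centre. -/
theorem Star.adj_of_low_erase (H : Hyp N a b) (hr : b x + N.M x - 1 ≤ N.d B x)
    (h : Star N a b A x B) {y z v : V} (hy : y ∈ N.low b B)
    (hz : z ∈ N.low a A) (hn : ¬ 0 < N.μ y z) (hv : v ∈ N.low b (B.erase y)) : 0 < N.μ x v := by
  obtain ⟨-, -, -, l3, l4⟩ := h.leaf H hr hy hz hn
  have hyA : y ∉ A := fun h' => h.disj y h' (mem_low.mp hy).1
  exact l4.adj_of_two_low_left H hv (low_insert_self hyA l3) (low_insert hz hyA hn)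
    (by rintro rfl; exact hyA (mem_low.mp hz).1)

/-- If `v` were adjacent to `x`, the triangle `x y v` would keep `y` from every low vertex of `A`.
Transferring `y` would then give a star in which `y` stays low on its new side and `v` becomes low:
one low vertex more. -/
theorem BigStar.next_not_adj_center (H : Hyp N a b) (hr : b x + N.M x - 1 ≤ N.d B x)
    (h : BigStar N a b A x B) {y v : V} (hy : y ∈ N.low b B) (hv : v ∈ N.low b (B.erase y))
    (hvl : v ∉ N.low b B) (hvy : 0 < N.μ v y) : ¬ 0 < N.μ x v := by
  intro hxv
  obtain ⟨hyB, -⟩ := mem_low.mp hy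
  have hyA : y ∉ A := fun h' => h.disj y h' hyB
  have hn : ∀ z ∈ N.low a A, ¬ 0 < N.μ y z := by
    intro z hz hyz
    have := N.edge_unique_triangle x y v z (h.adjB y hy) hxv (by rwa [N.symm]) (h.adjA z hz) hyz
    subst this
    have := h.disj v (mem_low.mp hz).1
    have := (mem_low.mp hv).1
    grind
  obtain ⟨z, hz⟩ := h.low_left H
  obtain ⟨-, l1, -, l3, l4⟩ := h.leaf H hr hy hz (hn z hz)
  have hz' := low_insert hz hyA (hn z hz)
  have hy' := low_insert_self hyA l3
  have hst : Star N a b (insert y A) x (B.erase y) :=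
    l4.star_of_two_low_left H (l4.low_adj_left H (by
      rw [d_insert hyA]
      linarith [h.le_left H])) hy' hz'
      (by rintro rfl; exact hyA (mem_low.mp hz).1)
  have h1 := h.card_le _ _ _ hst
  have hyl : y ∉ N.low a A := fun h' => hyA (mem_low.mp h').1
  have h2 : (N.low a A).card + 1 ≤ (N.low a (insert y A)).card := by
    rw [← Finset.card_insert_of_notMem hyl]
    refine Finset.card_le_card fun u hu => ?_
    rcases Finset.mem_insert.mp hu with rfl | hu
    · exact hy'
    · exact low_insert hu hyA (hn u hu)
  have h3 : (N.low b B).card ≤ (N.low b (B.erase y)).card := by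
    have h4 : v ∉ (N.low b B).erase y := by grind
    rw [← Finset.card_erase_add_one hy, ← Finset.card_insert_of_notMem h4]
    refine Finset.card_le_card fun u hu => ?_
    rcases Finset.mem_insert.mp hu with rfl | hu
    · exact hv
    · exact low_erase (Finset.mem_of_mem_erase hu) (Finset.ne_of_mem_erase hu)
  omega

/-- The quadrilateral `x y v y'` keeps `v` from `x`, and `y`, `y'` from the low vertices of `A`.
Once `y` and `y'` are both transferred, they are two low vertices facing the low vertex `v`, so the
centre must be adjacent to `v`. -/
theorem Star.no_next_quad (H : Hyp N a b) (hr : b x + N.M x - 1 ≤ N.d B x)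
    (h : Star N a b A x B) {y y' v : V} (hy : y ∈ N.low b B) (hy' : y' ∈ N.low b B)
    (hyy' : y ≠ y') (hv : v ∈ B) (hvy : 0 < N.μ v y) (hvy' : 0 < N.μ v y')
    (hvd : N.d ((B.erase y).erase y') v < b v) : False := by
  obtain ⟨hyB, -⟩ := mem_low.mp hy
  obtain ⟨hyB', -⟩ := mem_low.mp hy'
  have hyA : y ∉ A := fun h' => h.disj y h' hyB
  have hyA' : y' ∉ A := fun h' => h.disj y' h' hyB'
  have hxy := h.adjB y hy
  have hxy' := h.adjB y' hy'
  have hvx : v ≠ x := by rintro rfl; exact h.xB hv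
  have hxv : ¬ 0 < N.μ x v := fun h1 =>
    hyy' (N.edge_unique_triangle x v y y' h1 hxy hvy hxy' hvy')
  have hadj : ∀ z, 0 < N.μ x z → ¬ 0 < N.μ y z ∧ ¬ 0 < N.μ y' z := fun z hz =>
    ⟨fun h1 => N.quad_no_triangle x y v y' z hxy (by rwa [N.symm]) hvy' (by rwa [N.symm])
      hvx.symm hyy' hz h1,
    fun h1 => N.quad_no_triangle x y' v y z hxy' (by rwa [N.symm]) hvy (by rwa [N.symm])
      hvx.symm hyy'.symm hz h1⟩
  obtain ⟨z, hz⟩ := h.low_left H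
  have hzA := (mem_low.mp hz).1
  have hxz := h.adjA z hz
  obtain ⟨n1, n2⟩ := hadj z hxz
  obtain ⟨-, l1, l2, l3, l4⟩ := h.leaf H hr hy hz n1
  obtain ⟨-, l1', l2', l3', -⟩ := h.leaf H hr hy' hz n2
  have hind := eq_zero_of_not_adj (h.low_indep H hr hy hy')
  have hind' : N.μ y' y = 0 := by rw [N.symm, hind]
  have hvz : N.μ v z = 0 := by
    refine eq_zero_of_not_adj fun h1 => ?_
    have := common_nbr_three hvx.symm hxz h1 hxy hvy hxy' hvy' (by grind) (by grind)
    exact hyy' this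
  have hyB2 : y' ∈ B.erase y := by grind
  have hyA2 : y' ∉ insert y A := by grind
  have hv2 : v ∈ (B.erase y).erase y' := by have := ne_of_adj hvy; have := ne_of_adj hvy'; grind
  have hyl := low_insert_self hyA l3
  have hyl2 : y ∈ N.low a (insert y' (insert y A)) := low_insert hyl hyA2 (by rw [hind']; simp)
  have hd1 : N.d (B.erase y) y' = b y' - 1 := by rw [d_erase hyB, hind']; linarith
  have hd2 : N.d (insert y A) y' = a y' - 1 := by rw [d_insert hyA, hind']; linarith
  have hl := l4.le_right H
  by_cases hc : b x ≤ N.d (B.erase y) x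
  · have hm := l4.transfer_of_eq H hyB2 hd1 hd2 (by linarith)
    exact hxv (hm.adj_of_two_low_left H (mem_low.mpr ⟨hv2, hvd⟩) hyl2
      (low_insert_self hyA2 hd2) hyy')
  -- Here `x` has no slack left for a second transfer. Moving `z` from `A` to `B` first restores one
  -- edge, and `z` interferes with neither `y'` nor `v`.
  · have hx1 : N.d (B.erase y) x = b x - 1 := by omega
    have tx := l4.tot x
    rw [N.self] at tx
    have Hx := H.deg x
    have Mx := H.one_le_M x
    have mz := N.le_M x z
    have hzl := low_insert hz hyA n1
    have hyl' : y' ∈ N.low b (B.erase y) := low_erase hy' hyy'.symm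
    obtain ⟨-, k1, k2, k3, k4⟩ := l4.symm.leaf H.symm hzl hyl'
      (by rw [N.symm]; exact n2) (by linarith) (by linarith)
    have hz2 : z ∈ insert y A := by grind
    have hz3 : z ∉ B.erase y := fun h' => h.disj z hzA (by grind)
    have hzy' : z ≠ y' := by rintro rfl; exact hyA' hzA
    have hzy : z ≠ y := by rintro rfl; exact hyA hzA
    have e1 : N.μ y' z = 0 := eq_zero_of_not_adj n2
    have hd3 : N.d (insert z (B.erase y)) y' = b y' - 1 := by rw [d_insert hz3, e1]; linarith
    have hd4 : N.d ((insert y A).erase z) y' = a y' - 1 := by rw [d_erase hz2, e1]; linarith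
    have hm := k4.symm.transfer_of_eq H (y := y') (by grind) hd3 hd4
      (by rw [d_insert hz3, hx1]; linarith)
    have hy3 : y' ∉ (insert y A).erase z := by grind
    refine hxv (hm.adj_of_two_low_left H (z := y) (z' := y') (mem_low.mpr ⟨?_, ?_⟩) ?_
      (low_insert_self hy3 hd4) hyy')
    · grind
    · have e2 : (insert z (B.erase y)).erase y' = insert z ((B.erase y).erase y') := by grind
      rw [e2, d_insert (by grind), hvz]
      linarith
    · refine low_insert (low_erase hyl hzy.symm) hy3 (by rw [hind']; simp)

/-- The structure of a largest star: there is a single low vertex `z` in `A`, it spans a triangle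
with the centre and a low vertex `y` in `B`, and some vertex `v` hangs at `y`. -/
theorem BigStar.exists_triangle (H : Hyp N a b) (hr : b x + N.M x - 1 ≤ N.d B x)
    (h : BigStar N a b A x B) :
    ∃ z y v, N.low a A = {z} ∧ y ∈ N.low b B ∧ 0 < N.μ y z ∧ v ∈ B ∧ v ∉ N.low b B ∧
      ¬ 0 < N.μ x v ∧ 0 < N.μ v y ∧ (∀ y' ∈ N.low b B, 0 < N.μ v y' → y' = y) ∧
      N.d (B.erase y) v < b v := by
  obtain ⟨y₀, hy₀, z₀, hz₀, hn₀⟩ := h.exists_not_adj H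
  have hne : (B \ N.low b B).Nonempty := by
    obtain ⟨-, -, l2, -, -⟩ := h.leaf H hr hy₀ hz₀ hn₀
    obtain ⟨u, hu, hadj⟩ := exists_adj_of_d_pos (N := N) (S := B) (v := y₀)
      (by linarith [H.hb y₀])
    exact ⟨u, Finset.mem_sdiff.mpr ⟨hu, fun hl => h.low_indep H hr hy₀ hl hadj⟩⟩
  obtain ⟨v, hv, hvd⟩ := h.degB _ Finset.sdiff_subset hne
  obtain ⟨hvB, hvl⟩ := Finset.mem_sdiff.mp hv
  have hvd2 := le_d_of_not_low hvB hvl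
  -- The degree of `v` is too small once all low vertices are gone, and only low neighbours of `v`
  -- can make up the deficit.
  have hsub : ∀ T : Finset V, B \ N.low b B ⊆ T → T ⊆ B →
      (∀ y ∈ N.low b B, y ∈ T → ¬ 0 < N.μ v y) → N.d T v < b v := by
    intro T hT hTB hcond
    by_contra! hc
    obtain ⟨u, hu, hadj⟩ := exists_adj_of_d_lt (N := N) hT (hvd.trans_le hc)
    exact hcond u (by grind) (by grind) hadj
  obtain ⟨y, hy, hvy⟩ : ∃ y ∈ N.low b B, 0 < N.μ v y := by
    by_contra! hc
    exact absurd (hsub B (by grind) subset_rfl fun y hy _ => not_lt.mpr (hc y hy))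
      (not_lt.mpr hvd2)
  by_cases huniq : ∀ y' ∈ N.low b B, 0 < N.μ v y' → y' = y
  · have hd : N.d (B.erase y) v < b v :=
      hsub _ (by grind) (by grind) fun y' hy' h1 h2 => by have := huniq y' hy' h2; grind
    have hvlow : v ∈ N.low b (B.erase y) :=
      mem_low.mpr ⟨by have := ne_of_adj hvy; grind, hd⟩
    have hxv := h.next_not_adj_center H hr hy hvlow hvl hvy
    have hall : ∀ z ∈ N.low a A, 0 < N.μ y z := by
      intro z hz
      by_contra hn
      exact hxv (h.adj_of_low_erase H hr hy hz hn hvlow)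
    obtain ⟨z, hz⟩ := h.low_left H
    refine ⟨z, y, v, ?_, hy, hall z hz, hvB, hvl, hxv, hvy, huniq, hd⟩
    refine Finset.eq_singleton_iff_unique_mem.mpr ⟨hz, fun z' hz' => ?_⟩
    exact N.edge_unique_triangle x y z' z (h.adjB y hy) (h.adjA z' hz') (hall z' hz') (h.adjA z hz)
      (hall z hz)
  · push Not at huniq
    obtain ⟨y', hy', hvy', hne'⟩ := huniq
    have hvx : v ≠ x := by rintro rfl; exact h.xB hvB
    exfalso
    refine h.no_next_quad H hr hy hy' hne'.symm hvB hvy hvy' (hsub _ (by grind) (by grind) ?_)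
    intro w hw hwT hvw
    have := common_nbr_three hvx (p := y) (q := y') (r := w) hvy (h.adjB y hy) hvy' (h.adjB y' hy')
      hvw (h.adjB w hw) hne'.symm (by grind)
    grind

end Net

/-! ### The corner at the centre of a largest star. -/

namespace Net

variable {V : Type*} [DecidableEq V] {N : Net V} {a b : V → ℤ} [Fintype V]
variable {A B : Finset V} {x : V}

/-- The neighbourhood of the centre of a largest star: a triangle `x`, `z`, `y` with
`z ∈ A` and `y ∈ B`, and pendant vertices `q ∈ B` at `x`, `u ∈ A` at `z` and `v ∈ B` at `y`. -/
structure Corner (N : Net V) (a b : V → ℤ) (A : Finset V) (x : V) (B : Finset V)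
    (z y q u v : V) : Prop where
  lowA : N.low a A = {z}
  lowB : N.low b B = {y, q}
  hyq : y ≠ q
  yz : 0 < N.μ y z
  qz : ¬ 0 < N.μ q z
  yq : ¬ 0 < N.μ y q
  xq : N.μ x q = 1
  dAq : N.d A q = a q - 1
  dBq : N.d B q = b q - 1
  xz : N.μ x z = N.M x
  xy : N.μ x y = N.M x
  dAx : N.d A x = a x + N.M x - 2
  dBx : N.d B x = b x + N.M x - 1
  starY : Star N a b A y (insert x (B.erase y))
  x_lowY : x ∈ N.low b (insert x (B.erase y))
  v_lowY : v ∈ N.low b (insert x (B.erase y))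
  starZ : Star N a b (insert x ((insert q A).erase z)) z (B.erase q)
  x_lowZ : x ∈ N.low a (insert x ((insert q A).erase z))
  u_lowZ : u ∈ N.low a (insert x ((insert q A).erase z))
  y_lowZ : y ∈ N.low b (B.erase q)
  hu : u ∈ A
  uz : 0 < N.μ u z
  ux : ¬ 0 < N.μ x u
  uy : ¬ 0 < N.μ y u
  uq : ¬ 0 < N.μ q u
  hv : v ∈ B
  vy : 0 < N.μ v y
  vx : ¬ 0 < N.μ x v
  vq : ¬ 0 < N.μ v q
  vz : ¬ 0 < N.μ v z

/-- `BigStar.exists_triangle` supplies `x z y` and `v`; a second low vertex of `B` serves as `q`,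
and `u` is a vertex turning low when `z` leaves `A`. Recentring at `y` and at `z` forces the degrees
and multiplicities at `x` to be extremal. -/
theorem BigStar.exists_corner (H : Hyp N a b) (hr : b x + N.M x - 1 ≤ N.d B x)
    (h : BigStar N a b A x B) : ∃ z y q u v, Corner N a b A x B z y q u v := by
  obtain ⟨z, y, v, hL, hy, yz, hvB, hvl, vx, vy, huniq, hvd⟩ := h.exists_triangle H hr
  have hz : z ∈ N.low a A := by simp [hL]
  obtain ⟨hzA, hzd⟩ := mem_low.mp hz
  obtain ⟨hyB, hyd⟩ := mem_low.mp hy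
  have hxz := h.adjA z hz
  have hxy := h.adjB y hy
  obtain ⟨q, hq, hqy⟩ : ∃ q ∈ N.low b B, q ≠ y := by
    have h3 := h.three_le
    rw [hL, Finset.card_singleton] at h3
    obtain ⟨p, hp, p', hp', hne⟩ := Finset.one_lt_card.mp (show 1 < (N.low b B).card by omega)
    by_cases hpy : p = y
    · exact ⟨p', hp', by grind⟩
    · exact ⟨p, hp, hpy⟩
  obtain ⟨hqB, hqd⟩ := mem_low.mp hq
  have hxq := h.adjB q hq
  have hqA : q ∉ A := fun h' => h.disj q h' hqB
  have hyA : y ∉ A := fun h' => h.disj y h' hyB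
  have hzB := h.disj z hzA
  have qz' : ∀ p ∈ N.low b B, p ≠ y → ¬ 0 < N.μ p z := fun p hp hpy h1 =>
    hpy (N.edge_unique_triangle x z p y hxz (h.adjB p hp) (by rwa [N.symm]) hxy (by rwa [N.symm]))
  have qz := qz' q hq hqy
  have yq := h.low_indep H hr hy hq
  obtain ⟨-, q1, q2, q3, q4⟩ := h.leaf H hr hq hz qz
  have vz : ¬ 0 < N.μ v z := fun h1 => by
    have := N.edge_unique_triangle y z x v yz (by rwa [N.symm]) (by rwa [N.symm]) (by rwa [N.symm])
      (by rwa [N.symm])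
    subst this
    exact h.xB hvB
  have vq : ¬ 0 < N.μ v q := fun h1 => hqy (huniq q hq h1)
  -- the pendant vertex at `z`
  obtain ⟨u, hu⟩ : ∃ u, u ∈ N.low a (A.erase z) := by
    refine (h.degA.mono (Finset.erase_subset _ _)).low_nonempty ?_
    obtain ⟨p, hp, hadj⟩ := exists_adj_of_d_pos (N := N) (S := A) (v := q)
      (by linarith [H.ha q])
    exact ⟨p, by grind⟩
  obtain ⟨huA', hud⟩ := mem_low.mp hu
  have huA : u ∈ A := by grind
  have huz' : u ≠ z := by grind
  have huB := h.disj u huA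
  have hux' : u ≠ x := by rintro rfl; exact h.xA huA
  have uz : 0 < N.μ u z := by
    by_contra hc
    rw [d_erase hzA, eq_zero_of_not_adj hc, sub_zero] at hud
    have : u ∈ N.low a A := mem_low.mpr ⟨huA, hud⟩
    grind
  have ux : ¬ 0 < N.μ x u := fun h1 => by
    have := N.edge_unique_triangle x z u y hxz h1 (by rwa [N.symm]) hxy (by rwa [N.symm])
    exact huB (this ▸ hyB)
  have uy : ¬ 0 < N.μ y u := fun h1 =>
    hux' (N.edge_unique_triangle y z u x yz h1 (by rwa [N.symm]) (by rwa [N.symm])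
      (by rwa [N.symm]))
  have uq : ¬ 0 < N.μ q u := fun h1 =>
    N.quad_no_triangle x z u q y hxz (by rwa [N.symm]) (by rwa [N.symm]) (by rwa [N.symm])
      hux'.symm (by grind) hxy (by rwa [N.symm])
  have Mx := H.one_le_M x
  have Hx := H.deg x
  have tx := h.tot x
  rw [N.self] at tx
  have hyx := N.symm x y
  have hzx := N.symm x z
  have hxBy : x ∉ B.erase y := by have := h.xB; grind
  have hvlow : v ∈ N.low b (B.erase y) := mem_low.mpr ⟨by have := ne_of_adj vy; grind, hvd⟩
  -- recentring at `y`
  have hY : N.d B x = b x + N.M x - 1 ∧ N.μ x y = N.M x ∧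
      Max N a b A y (insert x (B.erase y)) ∧ N.d B y = b y - 1 := by
    obtain ⟨hy1, hsw⟩ := h.swap H hy (by linarith) (by linarith [N.le_M x y])
    have mle := N.le_M x y
    rcases hsw with ⟨h3, h4⟩ | ⟨h3, h4, h5, h6⟩
    · exact ⟨by omega, by omega, h4, hy1⟩
    -- If `y` is transferred instead, `v` is low and misses `x`, so `x` can be absorbed into `B` and
    -- `y` taken out again as centre: the exchange is reached by a detour.
    · have h7 := h6.symm.eq_of_low_not_adj H.symm hvlow vx
      have h8 := h7
      rw [d_erase hyB] at h8
      have ty := h.tot y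
      have hyl : y ∈ N.low a (insert y A) := low_insert_self hyA (by omega)
      have h9 := ((h6.pairMax_right H h7).left H hyl).2
      rw [Finset.erase_insert hyA] at h9
      exact ⟨by omega, by omega, h9, hy1⟩
  obtain ⟨hdBx, hmxy, hmaxY, hdBy⟩ := hY
  have hxlowY : x ∈ N.low b (insert x (B.erase y)) :=
    low_insert_self hxBy (by rw [d_erase hyB]; linarith)
  have hvlowY : v ∈ N.low b (insert x (B.erase y)) := low_insert hvlow hxBy vx
  have hvx : x ≠ v := by rintro rfl; exact h.xB hvB
  have hstarY : Star N a b A y (insert x (B.erase y)) := by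
    refine hmaxY.star_of_two_low_right H (hmaxY.low_adj_right H ?_) hxlowY hvlowY hvx
    rw [d_insert hxBy, d_erase hyB, N.self]
    linarith
  -- recentring at `z`
  have hzl : z ∈ N.low a (insert q A) := low_insert hz hqA qz
  have hzqA : z ∈ insert q A := by grind
  have huqA : u ∈ (insert q A).erase z := by grind
  have hulow : u ∈ N.low a ((insert q A).erase z) := by
    have e : (insert q A).erase z = insert q (A.erase z) := by
      have : q ≠ z := by rintro rfl; exact hqA hzA
      grind
    rw [e]
    exact low_insert hu (by grind) uq
  have hxqA : x ∉ (insert q A).erase z := by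
    have := h.xA
    have := ne_of_adj hxq
    grind
  have hZ : N.d A x = a x + N.M x - 2 ∧ N.μ x z = N.M x ∧
      Max N a b (insert x ((insert q A).erase z)) z (B.erase q) ∧
      N.d (insert q A) z = a z - 1 := by
    have mle := N.le_M x z
    have hdx : N.d (insert q A) x = N.d A x + 1 := by rw [d_insert hqA, q1]
    -- Transferring the leaf `q` first gives `x` the one extra edge to the side of `z` that the swap
    -- requires.
    obtain ⟨hz1, hsw⟩ := q4.symm.swap H.symm hzl (by linarith) (by linarith)
    rcases hsw with ⟨h3, h4⟩ | ⟨h3, h4, h5, h6⟩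
    · exact ⟨by omega, by omega, h4.symm, hz1⟩
    · have h7 := h6.symm.eq_of_low_not_adj H hulow ux
      have h8 := h7
      rw [d_erase hzqA] at h8
      have tz := q4.tot z
      have hzBq : z ∉ B.erase q := by grind
      have hzl' : z ∈ N.low b (insert z (B.erase q)) := low_insert_self hzBq (by omega)
      have h9 := ((h6.symm.pairMax h7).right H hzl').2
      rw [Finset.erase_insert hzBq] at h9
      exact ⟨by omega, by omega, h9, hz1⟩
  obtain ⟨hdAx, hmxz, hmaxZ, hdAz⟩ := hZ
  have hxlowZ : x ∈ N.low a (insert x ((insert q A).erase z)) :=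
    low_insert_self hxqA (by rw [d_erase hzqA, d_insert hqA]; linarith)
  have hulowZ : u ∈ N.low a (insert x ((insert q A).erase z)) := low_insert hulow hxqA ux
  have hstarZ : Star N a b (insert x ((insert q A).erase z)) z (B.erase q) := by
    refine hmaxZ.star_of_two_low_left H (hmaxZ.low_adj_left H ?_) hxlowZ hulowZ hux'.symm
    rw [d_insert hxqA, d_erase hzqA, N.self]
    linarith
  -- A further low `p` would be low in the star at `z`, hence adjacent to `z`, giving a second
  -- triangle on the edge `x z`.
  have hlowB : N.low b B = {y, q} := by
    refine Finset.Subset.antisymm (fun p hp => ?_) (by grind)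
    by_contra hpc
    have hpy : p ≠ y := by grind
    have hpq : p ≠ q := by grind
    have := hstarZ.adjB p (low_erase hp hpq)
    rw [N.symm] at this
    exact qz' p hp hpy this
  exact ⟨z, y, q, u, v, hL, hlowB, hqy.symm, yz, qz, yq, q1, q3, q2, hmxz, hmxy, hdAx, hdBx,
    hstarY, hxlowY, hvlowY, hstarZ, hxlowZ, hulowZ, low_erase hy hqy.symm, huA, uz, ux, uy, uq,
    hvB, vy, vx, vq, vz⟩

end Net

/-! ### The symmetric configuration and the final contradiction. -/

namespace Net

variable {V : Type*} [DecidableEq V] {N : Net V} {a b : V → ℤ} [Fintype V]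

/-- A triangle `p` with a pendant edge `p i`, `q i` at each vertex, and a partition `A`, `B` of the
other vertices, such that all ways to distribute the six vertices give maximum triples. -/
structure Config (N : Net V) (a b : V → ℤ) (A B : Finset V) (p q : Fin 3 → V) : Prop where
  degA : N.Deg a A
  degB : N.Deg b B
  disj : ∀ v ∈ A, v ∉ B
  cover : ∀ v, v ∈ A ∨ v ∈ B ∨ (∃ i, v = p i) ∨ ∃ i, v = q i
  pA : ∀ i, p i ∉ A
  pB : ∀ i, p i ∉ B
  qA : ∀ i, q i ∉ A
  qB : ∀ i, q i ∉ B
  p_ne_q : ∀ i j, p i ≠ q j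
  pp : ∀ i j, i ≠ j → 0 < N.μ (p i) (p j)
  pq : ∀ i, N.μ (p i) (q i) = 1
  pq' : ∀ i j, i ≠ j → N.μ (p i) (q j) = 0
  qq : ∀ i j, N.μ (q i) (q j) = 0
  dAp : ∀ i, N.d A (p i) = a (p i) - 2
  dBp : ∀ i, N.d B (p i) = b (p i) - 2
  dAq : ∀ i, N.d A (q i) = a (q i) - 1
  dBq : ∀ i, N.d B (q i) = b (q i) - 1
  bound : ∀ A' x' B', Triple N a b A' x' B' → N.psi a b A' x' B' ≤ N.f a A + N.f b B - 10

section

variable {A B : Finset V} {p q : Fin 3 → V}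

theorem Config.symm (c : Config N a b A B p q) : Config N b a B A p q where
  degA := c.degB
  degB := c.degA
  disj v h1 h2 := c.disj v h2 h1
  cover v := by have := c.cover v; tauto
  pA := c.pB
  pB := c.pA
  qA := c.qB
  qB := c.qA
  p_ne_q := c.p_ne_q
  pp := c.pp
  pq := c.pq
  pq' := c.pq'
  qq := c.qq
  dAp := c.dBp
  dBp := c.dAp
  dAq := c.dBq
  dBq := c.dAq
  bound A' x' B' h := by
    rw [psi_symm, add_comm (N.f b B)]
    exact c.bound _ _ _ h.symm

theorem Config.q_ne (c : Config N a b A B p q) {i j : Fin 3} (h : i ≠ j) : q i ≠ q j := by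
  intro h1
  have h2 := c.pq' i j h
  rw [← h1, c.pq] at h2
  exact one_ne_zero h2

theorem Config.insert_left (c : Config N a b A B p q) (j : Fin 3) :
    p j ∉ A ∧ q j ∉ insert (p j) A ∧ N.d (insert (p j) A) (q j) = a (q j) ∧
      N.Deg a (insert (q j) (insert (p j) A)) := by
  have h1 := c.qA j
  have h2 := c.pA j
  have h3 := c.p_ne_q j j
  have h4 : p j ∉ insert (q j) A := by grind
  refine ⟨h2, by grind, ?_, ?_⟩
  · rw [d_insert h2, c.dAq, N.symm, c.pq]; ring
  · rw [Finset.insert_comm]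
    refine (c.degA.insert (by rw [c.dAq]; linarith)).insert ?_
    rw [d_insert h1, c.dAp, c.pq]; linarith

theorem Config.arrange (c : Config N a b A B p q) {i j k : Fin 3} (hij : i ≠ j) (hik : i ≠ k)
    (hjk : j ≠ k) : Max N a b (insert (q j) (insert (p j) A)) (p i)
      (insert (q i) (insert (q k) (insert (p k) B))) := by
  obtain ⟨l1, l2, l3, l4⟩ := c.insert_left j
  obtain ⟨r1, r2, r3, r4⟩ := c.symm.insert_left k
  have hp : ∀ {i j}, i ≠ j → p i ≠ p j := fun h => ne_of_adj (c.pp _ _ h)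
  have r5 : q i ∉ insert (q k) (insert (p k) B) := by
    have := c.q_ne hik
    have := c.p_ne_q k i
    have := c.qB i
    grind
  have r6 : N.d (insert (q k) (insert (p k) B)) (q i) = b (q i) - 1 := by
    rw [d_insert r2, d_insert r1, c.dBq, c.qq, N.symm, c.pq' k i hik.symm]; ring
  have hall : ∀ m : Fin 3, m = i ∨ m = j ∨ m = k := by omega
  refine ⟨⟨?_, ?_, ?_, ?_, l4, r4.insert (by linarith)⟩, ?_⟩
  · have := c.pA i; have := c.p_ne_q i j; have := hp hij; grind
  · have := c.pB i; have := c.p_ne_q i k; have := c.p_ne_q i i; have := hp hik; grind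
  · intro v
    have := c.disj v
    have := c.qA
    have := c.pA
    have := c.qB
    have := c.pB
    have := c.p_ne_q
    have := hp hjk
    have := c.q_ne hjk
    have := c.q_ne hij.symm
    simp only [Finset.mem_insert]
    rintro (rfl | rfl | hv) <;> grind
  · intro v
    simp only [Finset.mem_insert]
    rcases c.cover v with h | h | ⟨m, rfl⟩ | ⟨m, rfl⟩
    · tauto
    · tauto
    · rcases hall m with rfl | rfl | rfl <;> tauto
    · rcases hall m with rfl | rfl | rfl <;> tauto
  · intro A' x' B' ht
    -- Relative to `A` and `B`, the vertices `p j` and `p k` contribute `-4` each, `q j` and `q k`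
    -- nothing, and `q i` contributes `-2`: this is the constant `10` in `bound`.
    refine (c.bound A' x' B' ht).trans (le_of_eq ?_)
    have h1 := c.pp i j hij
    have h2 := c.pp i k hik
    rw [psi_eq_of_le, f_insert l2, f_insert l1, f_insert r5, f_insert r2, f_insert r1, l3, r3, r6,
      c.dAp, c.dBp]
    · ring
    · rw [d_insert l2, d_insert l1, c.dAp, c.pq' i j hij]; linarith
    · rw [d_insert r5, d_insert r2, d_insert r1, c.dBp, c.pq' i k hik, c.pq]; linarith

/-- If `t` missed both, it would stay low when `p j` and `q j` join `A`. The other side has two low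
vertices, so `t` is adjacent to the centre, which may be either `p i` or `p k`. That is a second
triangle on `p i`, `p k`. -/
theorem Config.adj_p_or_q (H : Hyp N a b) (c : Config N a b A B p q) {t : V}
    (ht : t ∈ N.low a A) {i j k : Fin 3} (hij : i ≠ j) (hik : i ≠ k) (hjk : j ≠ k) :
    0 < N.μ t (p j) ∨ 0 < N.μ t (q j) := by
  by_contra! hc
  obtain ⟨htA, htd⟩ := mem_low.mp ht
  have key : ∀ {i k}, i ≠ j → i ≠ k → j ≠ k → 0 < N.μ (p i) t := by
    intro i k hij hik hjk
    have hm := c.arrange hij hik hjk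
    obtain ⟨l1, l2, l3, l4⟩ := c.insert_left j
    obtain ⟨r1, r2, r3, r4⟩ := c.symm.insert_left k
    have r5 : q i ∉ insert (q k) (insert (p k) B) := by
      have := c.q_ne hik
      have := c.p_ne_q k i
      have := c.qB i
      grind
    refine hm.adj_of_two_low H (y := p k) (y' := q i) ?_ ?_ ?_ (c.p_ne_q k i)
    · exact low_insert (low_insert ht l1 (by rw [N.symm]; exact not_lt.mpr hc.1)) l2
        (by rw [N.symm]; exact not_lt.mpr hc.2)
    · refine mem_low.mpr ⟨by grind, ?_⟩
      rw [d_insert r5, d_insert r2, d_insert r1, N.self, c.dBp, c.pq, c.pq' k i hik.symm]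
      linarith
    · refine mem_low.mpr ⟨by grind, ?_⟩
      rw [d_insert r5, d_insert r2, d_insert r1, N.self, c.dBq, c.qq, N.symm, c.pq' k i hik.symm]
      linarith
  have h1 := key hij hik hjk
  have h2 := key hjk.symm hik.symm hij.symm
  have := N.edge_unique_triangle (p i) (p k) t (p j) (c.pp i k hik) h1 h2 (c.pp i j hij)
    (c.pp k j hjk.symm)
  exact c.pA j (this ▸ htA)

/-- If `t` were adjacent to `p j`, then its neighbour among `p i`, `q i` would close a triangle or a
quadrilateral on the edge `p i`, `p j` of the given triangle. -/
theorem Config.adj_q (H : Hyp N a b) (c : Config N a b A B p q) {t : V}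
    (ht : t ∈ N.low a A) {i j k : Fin 3} (hij : i ≠ j) (hik : i ≠ k) (hjk : j ≠ k) :
    0 < N.μ t (q j) := by
  have htA := (mem_low.mp ht).1
  refine (c.adj_p_or_q H ht hij hik hjk).resolve_left fun hj => ?_
  have htp : t ≠ p k := by rintro rfl; exact c.pA k htA
  rcases c.adj_p_or_q H ht hij.symm hjk hik with hi | hi
  · exact htp (N.edge_unique_triangle (p i) (p j) t (p k) (c.pp i j hij) (by rwa [N.symm])
      (by rwa [N.symm]) (c.pp i k hik) (c.pp j k hjk))
  · exact N.quad_no_triangle (p i) (p j) t (q i) (p k) (c.pp i j hij) (by rwa [N.symm]) hi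
      (by rw [N.symm, c.pq]; norm_num) (by rintro rfl; exact c.pA _ htA) (c.p_ne_q j i)
      (c.pp i k hik) (c.pp j k hjk)

theorem Config.false (H : Hyp N a b) (c : Config N a b A B p q) : False := by
  have hA : A.Nonempty := by
    obtain ⟨v, hv, -⟩ := exists_adj_of_d_pos (N := N) (S := A) (v := q 0)
      (by rw [c.dAq]; linarith [H.ha (q 0)])
    exact ⟨v, hv⟩
  have hB : B.Nonempty := by
    obtain ⟨v, hv, -⟩ := exists_adj_of_d_pos (N := N) (S := B) (v := q 0)
      (by rw [c.dBq]; linarith [H.hb (q 0)])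
    exact ⟨v, hv⟩
  obtain ⟨t, ht⟩ := c.degA.low_nonempty hA
  obtain ⟨s, hs⟩ := c.degB.low_nonempty hB
  have d01 : (0 : Fin 3) ≠ 1 := by decide
  have d02 : (0 : Fin 3) ≠ 2 := by decide
  have d12 : (1 : Fin 3) ≠ 2 := by decide
  refine c.q_ne d12 (common_nbr_three (u := t) (v := s) ?_ (c.adj_q H ht d01.symm d12 d02)
    (c.symm.adj_q H.symm hs d01.symm d12 d02) (c.adj_q H ht d01 d02 d12)
    (c.symm.adj_q H.symm hs d01 d02 d12) (c.adj_q H ht d02 d01 d12.symm)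
    (c.symm.adj_q H.symm hs d02 d01 d12.symm) (c.q_ne d01) (c.q_ne d02))
  rintro rfl
  exact c.disj _ (mem_low.mp ht).1 (mem_low.mp hs).1

end

variable {A B : Finset V} {x : V}

/-- A corner has exactly three low vertices, the least a star may have, so every star is a largest
one. This lets the analysis be repeated at `y` and `z`. -/
theorem Corner.bigStar {z y q u v : V} (c : Corner N a b A x B z y q u v)
    (h : BigStar N a b A x B) {A' B' : Finset V} {x' : V} (h' : Star N a b A' x' B') :
    BigStar N a b A' x' B' where
  toStar := h'
  card_le A'' x'' B'' h'' := by
    have h1 := h.card_le _ _ _ h''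
    have h2 := h'.three_le
    rw [c.lowA, c.lowB, Finset.card_singleton, Finset.card_pair c.hyq] at h1
    omega

/-- The corner at the centre of a largest star with two low vertices in `B`. -/
theorem BigStar.exists_corner_of_two_low (H : Hyp N a b) (h : BigStar N a b A x B) {y y' : V}
    (hy : y ∈ N.low b B) (hy' : y' ∈ N.low b B) (hne : y ≠ y') :
    ∃ z y q u v, Corner N a b A x B z y q u v := by
  rcases h.rich H with hr | hr
  · exact h.exists_corner H hr
  · obtain ⟨z, _, _, _, _, c⟩ := h.symm.exists_corner H.symm hr
    have := c.lowA
    grind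

/-- The corners at `x`, `y` and `z` are built on the same triangle, with pendant vertices `q`, `v`
and `u` respectively. Together they fix all degrees, and removing these vertices from the two sides
leaves a `Config`. -/
theorem BigStar.false_of_rich (H : Hyp N a b) (h : BigStar N a b A x B)
    (hr : b x + N.M x - 1 ≤ N.d B x) : False := by
  obtain ⟨z, y, q, u, v, c⟩ := h.exists_corner H hr
  have hz : z ∈ N.low a A := by simp [c.lowA]
  have hy : y ∈ N.low b B := by simp [c.lowB]
  have hq : q ∈ N.low b B := by simp [c.lowB]
  have hzA := (mem_low.mp hz).1
  have hyB := (mem_low.mp hy).1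
  have hqB := (mem_low.mp hq).1
  have hzB := h.disj z hzA
  have huA := c.hu
  have huB := h.disj u huA
  have hyA : y ∉ A := fun h' => h.disj y h' hyB
  have hqA : q ∉ A := fun h' => h.disj q h' hqB
  have hvB := c.hv
  have hvA : v ∉ A := fun h' => h.disj v h' hvB
  have hxA := h.xA
  have hxB := h.xB
  have hxv : x ≠ v := by grind
  have hxu : x ≠ u := by grind
  have huz := ne_of_adj c.uz
  have hvy := ne_of_adj c.vy
  have hyq := c.hyq
  have hqv : q ≠ v := fun h' => c.yq (by rw [N.symm, h']; exact c.vy)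
  have Mx := H.one_le_M x
  -- the corner at `y`
  obtain ⟨z₁, y₁, q₁, u₁, v₁, c₁⟩ :=
    (c.bigStar h c.starY).exists_corner_of_two_low H c.x_lowY c.v_lowY hxv
  have hz₁ : z₁ = z := by
    have := c₁.lowA
    rw [c.lowA] at this
    simpa using this.symm
  rw [hz₁] at c₁
  have hv₁ : v ≠ y₁ := fun h' => c.vz (h' ▸ c₁.yz)
  have e1 := c.x_lowY
  have e2 := c.v_lowY
  rw [c₁.lowB] at e1 e2
  have hq₁ : q₁ = v := by grind
  have hy₁ : y₁ = x := by grind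
  rw [hq₁, hy₁] at c₁
  -- the corner at `z`
  obtain ⟨z₂, y₂, q₂, u₂, v₂, c₂⟩ :=
    (c.bigStar h c.starZ).symm.exists_corner_of_two_low H.symm c.x_lowZ c.u_lowZ hxu
  have hz₂ : z₂ = y := by
    have := c₂.lowA
    have hy' := c.y_lowZ
    rw [this] at hy'
    exact (Finset.mem_singleton.mp hy').symm
  rw [hz₂] at c₂
  have hu₂ : u ≠ y₂ := fun h' => c.uy (by rw [N.symm, h']; exact c₂.yz)
  have e3 := c.x_lowZ
  have e4 := c.u_lowZ
  rw [c₂.lowB] at e3 e4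
  have hq₂ : q₂ = u := by grind
  have hy₂ : y₂ = x := by grind
  rw [hq₂, hy₂] at c₂
  have hxBy : x ∉ B.erase y := by grind
  have hzqA : z ∈ insert q A := by grind
  have hqz : q ≠ z := by grind
  have hxqA : x ∉ (insert q A).erase z := by
    have : x ≠ q := by grind
    grind
  have huAz : u ∈ A.erase z := by grind
  have hqBy : q ∈ B.erase y := by grind
  have hvByq : v ∈ (B.erase y).erase q := by grind
  have uv : ¬ 0 < N.μ u v := fun h' =>
    N.quad_no_triangle z y v u x (by rw [N.symm]; exact c.yz) (by rw [N.symm]; exact c.vy)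
      (by rwa [N.symm]) c.uz (by grind) (by grind) (by rw [N.symm, c.xz]; linarith)
      (by rw [N.symm, c.xy]; linarith)
  have zero : ∀ {s t : V}, ¬ 0 < N.μ s t → N.μ s t = 0 ∧ N.μ t s = 0 := fun h' =>
    ⟨eq_zero_of_not_adj h', by rw [N.symm]; exact eq_zero_of_not_adj h'⟩
  obtain ⟨zq, zq'⟩ := zero c.qz
  obtain ⟨yq, yq'⟩ := zero c.yq
  obtain ⟨xu, xu'⟩ := zero c.ux
  obtain ⟨yu, yu'⟩ := zero c.uy
  obtain ⟨qu, qu'⟩ := zero c.uq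
  obtain ⟨xv, xv'⟩ := zero c.vx
  obtain ⟨vq, vq'⟩ := zero c.vq
  obtain ⟨vz, vz'⟩ := zero c.vz
  obtain ⟨uv, uv'⟩ := zero uv
  have xz := c.xz
  have xy := c.xy
  have xq := c.xq
  have yx := c₁.xy
  have yz := c₁.xz
  have yv := c₁.xq
  have zx := c₂.xy
  have zy := c₂.xz
  have zu := c₂.xq
  have uz := N.symm u z
  have vy := N.symm v y
  have qx := N.symm q x
  have k1 := c₁.dAx
  have k2 := c₁.dBx
  have k3 := c₁.dAq
  have k4 := c₁.dBq
  have k5 := c₂.dAx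
  have k6 := c₂.dBx
  have k7 := c₂.dAq
  have k8 := c₂.dBq
  have k9 := c.dAx
  have k10 := c.dBx
  have k11 := c.dAq
  have k12 := c.dBq
  rw [d_insert hxBy, d_erase hyB] at k2 k4
  rw [d_erase hqB] at k5 k7
  rw [d_insert hxqA, d_erase hzqA, d_insert hqA] at k6 k8
  have sy := N.self y
  have sz := N.self z
  have sx := N.self x
  have sq := N.self q
  have su := N.self u
  have sv := N.self v
  have dA : ∀ t, N.d ((A.erase z).erase u) t = N.d A t - N.μ t z - N.μ t u := fun t => by
    rw [d_erase huAz, d_erase hzA]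
  have dB : ∀ t, N.d (((B.erase y).erase q).erase v) t =
      N.d B t - N.μ t y - N.μ t q - N.μ t v := fun t => by
    rw [d_erase hvByq, d_erase hqBy, d_erase hyB]
  have cfg : Config N a b ((A.erase z).erase u) (((B.erase y).erase q).erase v)
      ![x, z, y] ![q, u, v] := by
    refine ⟨h.degA.mono (by grind), h.degB.mono (by grind), ?_, ?_, ?_, ?_, ?_, ?_, ?_, ?_, ?_, ?_,
      ?_, ?_, ?_, ?_, ?_, ?_⟩
    · intro w
      have := h.disj w
      grind
    · intro w
      have := h.cover w
      simp only [Fin.exists_fin_succ, Fin.exists_fin_zero]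
      simp
      grind
    · simp [Fin.forall_fin_succ]; grind
    · simp [Fin.forall_fin_succ]; grind
    · simp [Fin.forall_fin_succ]; grind
    · simp [Fin.forall_fin_succ]; grind
    · simp [Fin.forall_fin_succ]; grind
    · simp [Fin.forall_fin_succ]
      have := H.one_le_M z
      have := H.one_le_M y
      omega
    · simp [Fin.forall_fin_succ]; omega
    · simp [Fin.forall_fin_succ]; omega
    · simp [Fin.forall_fin_succ]; omega
    · simp [Fin.forall_fin_succ, dA]; omega
    · simp [Fin.forall_fin_succ, dB]; omega
    · simp [Fin.forall_fin_succ, dA]; omega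
    · simp [Fin.forall_fin_succ, dB]; omega
    · intro A' x' B' ht
      refine (h.le _ _ _ ht).trans (le_of_eq ?_)
      rw [h.psi_eq H, f_erase huAz, f_erase hzA, f_erase hvByq, f_erase hqBy, f_erase hyB,
        d_erase hzA, d_erase hqBy, d_erase hyB, d_erase hyB]
      omega
  exact cfg.false H

theorem BigStar.false (H : Hyp N a b) (h : BigStar N a b A x B) : False := by
  rcases h.rich H with hr | hr
  · exact h.false_of_rich H hr
  · exact h.symm.false_of_rich H.symm hr

theorem not_hyp [Nonempty V] (H : Hyp N a b) : False := by
  classical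
  -- a minimal feasible set gives a triple
  have hex : ∃ A x B, Triple N a b A x B := by
    let F := (Finset.univ : Finset (Finset V)).filter
      fun S => S.Nonempty ∧ ∀ v ∈ S, a v ≤ N.d S v
    have hF : F.Nonempty := by
      refine ⟨Finset.univ, Finset.mem_filter.mpr ⟨Finset.mem_univ _, Finset.univ_nonempty, ?_⟩⟩
      intro v _
      linarith [H.deg v, H.hb v, H.one_le_M v]
    obtain ⟨S, hS, hmin⟩ := Finset.exists_min_image F Finset.card hF
    obtain ⟨-, ⟨x, hx⟩, hf⟩ := Finset.mem_filter.mp hS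
    refine ⟨S.erase x, x, Sᶜ, by simp, by simpa using hx, by simp, fun v => ?_, ?_, ?_⟩
    · by_cases hv : v = x <;> by_cases hv' : v ∈ S <;> simp [hv, hv']
    · intro T hT hne
      by_contra! hc
      have h1 := hmin T (Finset.mem_filter.mpr ⟨Finset.mem_univ _, hne, hc⟩)
      have h2 := Finset.card_le_card hT
      have h3 := Finset.card_erase_lt_of_mem hx
      omega
    · exact H.deg_of_disjoint ⟨x, hx⟩ hf disjoint_compl_right
  have hmax : ∃ A x B, Max N a b A x B := by
    obtain ⟨A, x, B, ht⟩ := hex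
    obtain ⟨⟨A', x', B'⟩, h1, h2⟩ := Set.exists_max_image
      {t : Finset V × V × Finset V | Triple N a b t.1 t.2.1 t.2.2}
      (fun t => N.psi a b t.1 t.2.1 t.2.2) (Set.toFinite _) ⟨(A, x, B), ht⟩
    exact ⟨A', x', B', h1, fun A'' x'' B'' h => h2 (A'', x'', B'') h⟩
  obtain ⟨A, x, B, hm⟩ := hmax
  obtain ⟨A₁, x₁, B₁, hs⟩ := hm.exists_star H
  obtain ⟨⟨A', x', B'⟩, h1, h2⟩ := Set.exists_max_image
    {t : Finset V × V × Finset V | Star N a b t.1 t.2.1 t.2.2}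
    (fun t => (N.low a t.1).card + (N.low b t.2.2).card) (Set.toFinite _) ⟨(A₁, x₁, B₁), hs⟩
  exact BigStar.false H (A := A') (x := x') (B := B')
    ⟨h1, fun A'' x'' B'' h => h2 (A'', x'', B'') h⟩

/-- If all degrees are large enough, then the vertices can be partitioned into two nonempty sets
that are feasible for `a` and for `b`. -/
theorem exists_partition [Nonempty V] (ha : ∀ v, 2 ≤ a v) (hb : ∀ v, 2 ≤ b v)
    (deg : ∀ v, a v + b v + 2 * N.M v - 3 ≤ N.d Finset.univ v) :
    ∃ X : Finset V, X.Nonempty ∧ Xᶜ.Nonempty ∧ (∀ v ∈ X, a v ≤ N.d X v) ∧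
      ∀ v ∈ Xᶜ, b v ≤ N.d Xᶜ v := by
  classical
  by_contra hcon
  refine not_hyp (N := N) (a := a) (b := b) ⟨ha, hb, deg, fun S T hS hT hd hfS hfT => hcon ?_⟩
  let F := (Finset.univ : Finset (Finset V)).filter
    fun R => Disjoint S R ∧ R.Nonempty ∧ ∀ v ∈ R, b v ≤ N.d R v
  obtain ⟨R, hR, hmax⟩ := Finset.exists_max_image F Finset.card
    ⟨T, Finset.mem_filter.mpr ⟨Finset.mem_univ _, hd, hT, hfT⟩⟩
  obtain ⟨-, hSR, hRne, hfR⟩ := Finset.mem_filter.mp hR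
  have hsub : S ⊆ Rᶜ := fun v hv => by
    simpa using Finset.disjoint_left.mp hSR hv
  refine ⟨Rᶜ, hS.mono hsub, by rwa [compl_compl], fun v hv => ?_, by rwa [compl_compl]⟩
  -- A vertex `v` violating feasibility has at least `b v` edges to `R`, so it could be added to the
  -- maximal set `R`.
  by_contra! hc
  have hvS : v ∉ S := fun h => by linarith [hfS v h, d_mono (N := N) hsub v]
  have hvR : v ∉ R := by simpa using hv
  have htot : N.d R v + N.d Rᶜ v = N.d Finset.univ v := Finset.sum_add_sum_compl _ _
  have hins : insert v R ∈ F := by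
    refine Finset.mem_filter.mpr ⟨Finset.mem_univ _, ?_, Finset.insert_nonempty _ _, ?_⟩
    · exact Finset.disjoint_insert_right.mpr ⟨hvS, hSR⟩
    · intro w hw
      rw [d_insert hvR]
      rcases Finset.mem_insert.mp hw with rfl | hw
      · linarith [deg w, one_le_M ha hb deg w, N.nonneg w w]
      · linarith [hfR w hw, N.nonneg w v]
  have := hmax _ hins
  rw [Finset.card_insert_of_notMem hvR] at this
  omega

end Net

/-! ### From multigraphs to multiplicity functions. -/

namespace Graph

variable {α β : Type*} {G : Graph α β}

theorem multiplicity_comm (G : Graph α β) (u v : α) : G.multiplicity u v = G.multiplicity v u := by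
  simp only [multiplicity, G.isLink_comm]

theorem multiplicity_self [G.Loopless] (v : α) : G.multiplicity v v = 0 := by
  simp [multiplicity]

theorem finite_setOf_isLink (hE : E(G).Finite) (u v : α) : {e | G.IsLink e u v}.Finite :=
  hE.subset fun _ he => he.edge_mem

theorem adj_of_multiplicity_pos {u v : α} (h : 0 < G.multiplicity u v) : G.Adj u v := by
  obtain ⟨e, he⟩ := Set.nonempty_of_ncard_ne_zero h.ne'
  exact ⟨e, he⟩

theorem multiplicity_le_weight [G.Loopless] (hV : V(G).Finite) {u v : α} (hv : v ∈ V(G)) :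
    G.multiplicity u v ≤ G.weight u := by
  by_cases huv : v = u
  · subst huv; simp [multiplicity_self]
  · rw [multiplicity_comm]
    exact le_csSup ((hV.subset Set.sdiff_subset).image _).bddAbove ⟨v, ⟨hv, huv⟩, rfl⟩

theorem degIn_eq_sum [G.Loopless] (hE : E(G).Finite) (S : Finset α) (v : α) :
    G.degIn S v = ∑ u ∈ S, G.multiplicity v u := by
  classical
  induction S using Finset.induction_on with
  | empty => simp [degIn]
  | insert w S hw ih =>
    rw [Finset.sum_insert hw, ← ih]
    have h : {e | ∃ u ∈ (↑(insert w S) : Set α) \ {v}, G.IsLink e v u} =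
        {e | G.IsLink e v w} ∪ {e | ∃ u ∈ (↑S : Set α) \ {v}, G.IsLink e v u} := by
      ext e
      constructor
      · rintro ⟨u, ⟨hu, huv⟩, he⟩
        rcases Finset.mem_insert.1 hu with rfl | hu
        · exact Or.inl he
        · exact Or.inr ⟨u, ⟨hu, huv⟩, he⟩
      · rintro (he | ⟨u, ⟨hu, huv⟩, he⟩)
        · exact ⟨w, ⟨by simp, fun h => he.adj.ne h.symm⟩, he⟩
        · exact ⟨u, ⟨Finset.mem_insert_of_mem hu, huv⟩, he⟩
    rw [degIn, h, Set.ncard_union_eq _ (finite_setOf_isLink hE v w)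
      (hE.subset (by rintro e ⟨_, _, he⟩; exact he.edge_mem))]
    · rfl
    · rw [Set.disjoint_left]
      rintro e he ⟨u, ⟨hu, -⟩, he'⟩
      exact hw (IsLink.right_unique he he' ▸ hu)

namespace QuadrilateralsShareNoEdges

variable [G.Loopless]

theorem not_triangle (hG : G.QuadrilateralsShareNoEdges) {x y z w t : α} (hxy : G.Adj x y)
    (hyz : G.Adj y z) (hzw : G.Adj z w) (hwx : G.Adj w x) (hxz : x ≠ z) (hyw : y ≠ w)
    (hxt : G.Adj x t) (hyt : G.Adj y t) : False := by
  have hQ : G.IsQuadrilateral {s(x, y), s(y, z), s(z, w), s(w, x)} :=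
    ⟨x, y, z, w, by simp [hxy.ne, hxz, hwx.ne.symm, hyz.ne, hyw, hzw.ne], hxy, hyz, hzw, hwx, rfl⟩
  have hT : G.IsTriangle {s(x, y), s(y, t), s(t, x)} :=
    ⟨x, y, t, by simp [hxy.ne, hxt.ne, hyt.ne], hxy, hyt, hxt.symm, rfl⟩
  exact Set.disjoint_left.1 ((hG _ hQ).1 _ hT) (Set.mem_insert s(x, y) _) (Set.mem_insert _ _)

/-- Two triangles on `u v` with different apexes form the quadrilateral `u w v w'`, which shares the
edge `u w` with one of them. -/
theorem unique_triangle (hG : G.QuadrilateralsShareNoEdges) {u v w w' : α} (huv : G.Adj u v)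
    (huw : G.Adj u w) (hvw : G.Adj v w) (huw' : G.Adj u w') (hvw' : G.Adj v w') : w = w' := by
  by_contra hne
  exact hG.not_triangle huw hvw.symm hvw' huw'.symm huv.ne hne huv hvw.symm

theorem unique_quadrilateral (hG : G.QuadrilateralsShareNoEdges) {x y z w z' w' : α}
    (hxy : G.Adj x y) (hyz : G.Adj y z) (hzw : G.Adj z w) (hwx : G.Adj w x) (hxz : x ≠ z)
    (hyw : y ≠ w) (hyz' : G.Adj y z') (hzw' : G.Adj z' w') (hwx' : G.Adj w' x) (hxz' : x ≠ z')
    (hyw' : y ≠ w') : z = z' ∧ w = w' := by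
  have hQ : G.IsQuadrilateral {s(x, y), s(y, z), s(z, w), s(w, x)} :=
    ⟨x, y, z, w, by simp [hxy.ne, hxz, hwx.ne.symm, hyz.ne, hyw, hzw.ne], hxy, hyz, hzw, hwx, rfl⟩
  have hQ' : G.IsQuadrilateral {s(x, y), s(y, z'), s(z', w'), s(w', x)} :=
    ⟨x, y, z', w', by simp [hxy.ne, hxz', hwx'.ne.symm, hyz'.ne, hyw', hzw'.ne],
      hxy, hyz', hzw', hwx', rfl⟩
  have heq : ({s(x, y), s(y, z'), s(z', w'), s(w', x)} : Set (Sym2 α)) =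
      {s(x, y), s(y, z), s(z, w), s(w, x)} := by
    by_contra hne
    exact Set.disjoint_left.1 ((hG _ hQ).2 _ hQ' hne) (Set.mem_insert s(x, y) _)
      (Set.mem_insert _ _)
  have h1 : s(y, z') ∈ ({s(x, y), s(y, z), s(z, w), s(w, x)} : Set (Sym2 α)) := heq ▸ by simp
  have h2 : s(w', x) ∈ ({s(x, y), s(y, z), s(z, w), s(w, x)} : Set (Sym2 α)) := heq ▸ by simp
  simp only [Set.mem_insert_iff, Set.mem_singleton_iff, Sym2.eq_iff] at h1 h2
  have := hxy.ne
  have := hyz.ne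
  have := hwx.ne
  constructor <;> grind

end QuadrilateralsShareNoEdges

/-- The multiplicities and weights of a finite loopless multigraph. -/
noncomputable def toNet (G : Graph α β) [G.Loopless] (hV : V(G).Finite)
    (hG : G.QuadrilateralsShareNoEdges) : Net V(G) where
  μ u v := G.multiplicity u v
  M v := G.weight v
  nonneg _ _ := Int.natCast_nonneg _
  symm u v := by rw [multiplicity_comm]
  self v := by rw [multiplicity_self]; rfl
  le_M _ v := Int.ofNat_le.2 (multiplicity_le_weight hV v.2)
  edge_unique_triangle u v w w' h₁ h₂ h₃ h₄ h₅ := by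
    have adj (u v : V(G)) (h : 0 < (G.multiplicity u v : ℤ)) : G.Adj u v :=
      adj_of_multiplicity_pos (Int.natCast_pos.1 h)
    exact Subtype.ext <| hG.unique_triangle (adj _ _ h₁) (adj _ _ h₂) (adj _ _ h₃) (adj _ _ h₄)
      (adj _ _ h₅)
  quad_no_triangle x y z w t h₁ h₂ h₃ h₄ hxz hyw h₅ h₆ := by
    have adj (u v : V(G)) (h : 0 < (G.multiplicity u v : ℤ)) : G.Adj u v :=
      adj_of_multiplicity_pos (Int.natCast_pos.1 h)
    exact hG.not_triangle (adj _ _ h₁) (adj _ _ h₂) (adj _ _ h₃) (adj _ _ h₄)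
      (fun h => hxz (Subtype.ext h)) (fun h => hyw (Subtype.ext h)) (adj _ _ h₅) (adj _ _ h₆)
  quad_unique x y z w z' w' h₁ h₂ h₃ h₄ hxz hyw h₅ h₆ h₇ hxz' hyw' := by
    have adj (u v : V(G)) (h : 0 < (G.multiplicity u v : ℤ)) : G.Adj u v :=
      adj_of_multiplicity_pos (Int.natCast_pos.1 h)
    have := hG.unique_quadrilateral (adj _ _ h₁) (adj _ _ h₂) (adj _ _ h₃) (adj _ _ h₄)
      (fun h => hxz (Subtype.ext h)) (fun h => hyw (Subtype.ext h)) (adj _ _ h₅) (adj _ _ h₆)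
      (adj _ _ h₇) (fun h => hxz' (Subtype.ext h)) (fun h => hyw' (Subtype.ext h))
    exact ⟨Subtype.ext this.1, Subtype.ext this.2⟩

theorem toNet_d [G.Loopless] (hV : V(G).Finite) (hE : E(G).Finite)
    (hG : G.QuadrilateralsShareNoEdges) (S : Finset V(G)) (v : V(G)) :
    (G.toNet hV hG).d S v = G.degIn (Subtype.val '' (S : Set V(G))) v := by
  classical
  have h : Subtype.val '' (S : Set V(G)) =
      ((S.map ⟨_, Subtype.val_injective⟩ : Finset α) : Set α) := by
    simp
  rw [h, degIn_eq_sum hE, Finset.sum_map, Nat.cast_sum]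
  rfl

end Graph

theorem theorem5 {α β : Type*} (G : Graph α β) [G.Loopless]
    (hV : V(G).Finite) (hE : E(G).Finite) (hne : V(G).Nonempty)
    (hG : G.QuadrilateralsShareNoEdges)
    (a b : α → ℕ) (ha : ∀ x ∈ V(G), 2 ≤ a x) (hb : ∀ x ∈ V(G), 2 ≤ b x)
    (hd : ∀ x ∈ V(G), (G.degIn V(G) x : ℤ) ≥ a x + b x + 2 * G.weight x - 3) :
    ∃ X Y : Set α, G.IsFeasiblePartition a b X Y := by
  classical
  have : Fintype V(G) := hV.fintype
  have : Nonempty V(G) := hne.to_subtype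
  obtain ⟨X, hX, hX', hXa, hXb⟩ := Net.exists_partition (N := G.toNet hV hG)
    (a := fun v => (a v : ℤ)) (b := fun v => (b v : ℤ))
    (fun v => Int.ofNat_le.2 (ha v v.2)) (fun v => Int.ofNat_le.2 (hb v v.2)) fun v => by
      rw [Graph.toNet_d hV hE hG, Finset.coe_univ, Set.image_univ, Subtype.range_coe]
      exact hd v v.2
  refine ⟨Subtype.val '' (X : Set V(G)), Subtype.val '' ((Xᶜ : Finset V(G)) : Set V(G)),
    (Finset.coe_nonempty.2 hX).image _, (Finset.coe_nonempty.2 hX').image _, ?_, ?_, ?_, ?_⟩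
  · rw [Set.disjoint_image_iff Subtype.val_injective, Finset.disjoint_coe]
    exact disjoint_compl_right
  · rw [← Set.image_union, Finset.coe_compl, Set.union_compl_self, Set.image_univ,
      Subtype.range_coe]
  · rintro _ ⟨v, hv, rfl⟩
    have := hXa v hv
    rw [Graph.toNet_d hV hE hG] at this
    exact_mod_cast this
  · rintro _ ⟨v, hv, rfl⟩
    have := hXb v hv
    rw [Graph.toNet_d hV hE hG] at this
    exact_mod_cast this
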